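/- Fix $n\in\mathbb{N}=\{0,1,2,\dots\}$ and $k\in\mathbb{Z}$, and let $J\subseteq\mathbb{R}$ be an open interval containing $0$. For $t\in J$ let $(c_j)_{j\in\mathbb{Z}}=(c_j(t))_{j\in\mathbb{Z}}$ be a sequence of complex numbers with $c_{-j}=\overline{c_j}$ such that all Toeplitz matrices $C_N(t)=(c_{l-j}(t))_{j,l=1}^{N}$, $N\ge 1$, are positive definite; assume that $c_j$ does not depend on $t$ for $j\ne\pm k$ and that $c_k$ is a continuously differentiable function of $t\in J$. Let $b:J\to\mathbb{S}^1=\{z\in\mathbb C:|z|=1\}$ be continuously differentiable. Let $Q_0=1$ and $$Q_m(z;t)=\frac{1}{\det C_m(t)}\det\begin{pmatrix} c_0&\overline{c_1}&\cdots&\overline{c_m}\\ c_1&c_0&\cdots&\overline{c_{m-1}}\\ \vdots&\vdots&\ddots&\vdots\\ c_{m-1}&c_{m-2}&\cdots&\overline{c_1}\\ 1&z&\cdots&z^m\end{pmatrix}$$ be the monic orthogonal polynomials on the unit circle, $Q_m^*(z;t)=z^m\overline{Q_m(1/\overline z;t)}$, and $q_m=Q_m/\|Q_m\|$, the norm being that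 of the inner product on polynomials with $\langle z^j,z^l\rangle=c_{l-j}(t)$ (linear in the first argument). Let $K_n(w,z;t)=\sum_{j=0}^n\overline{q_j(w;t)}\,q_j(z;t)$ be the CD kernel and $P_{n+1}(z;t)=zQ_n(z;t)-\overline{b(t)}\,Q_n^*(z;t)$ the monic paraorthogonal polynomial. Write $I_\epsilon=(-\epsilon,\epsilon)$ and $C_\delta(\zeta_0)=\{z\in\mathbb{S}^1:|z-\zeta_0|<\delta\}$. If $P_{n+1}(\zeta_0;0)=0$, then there exist $\epsilon>0$ with $I_\epsilon\subseteq J$, $\delta>0$, and a unique function $\zeta:I_\epsilon\to C_\delta(\zeta_0)$ such that $P_{n+1}(\zeta(t);t)=0$ for all $t\in I_\epsilon$; moreover $\zeta$ is differentiable on $I_\epsilon$ and $\zeta(0)=\zeta_0$. It can be written as $\zeta(t)=e^{i\varphi(t)}$ with $\varphi:I_\epsilon\to\mathbb{R}$ differentiable, and for every such $\varphi$ the following holds. (i) If $P_{n+1}(e^{-i\varphi(t)};t)=0$ for all $t\in I_\epsilon$, then for all $t\in I_\epsilon$ $$\operatorname{sgn}\varphi'(t)=-\operatorname{sgn}\bigl(\operatorname{Im}e^{i\varphi(t)}\bigr)\,\operatorname{sgn}\operatorname{Re}\bigl(\overline{b_k(t)}\,c_k'(t)\bigr),$$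 where (the first integrand being integrable) $$b_k(t)=-\int_0^{2\pi} e^{-ik\theta}\,\frac{\sin\frac{\theta-\varphi(t)}{2}}{\sin\frac{\theta+\varphi(t)}{2}}\,\bigl|K_n(e^{i\varphi(t)},e^{i\theta};t)\bigr|^2\frac{d\theta}{2\pi}$$ $$=-\frac{e^{i\varphi(t)}\,|Q_n(e^{i\varphi(t)};t)|^2}{Q_n(e^{-i\varphi(t)};t)\,\overline{Q_n(e^{i\varphi(t)};t)}}\int_0^{2\pi} e^{-ik\theta}K_n(e^{i\varphi(t)},e^{i\theta};t)\,K_n(e^{i\theta},e^{-i\varphi(t)};t)\frac{d\theta}{2\pi}.$$ (ii) If $\theta_0\in\mathbb{R}$ and $P_{n+1}(e^{i\theta_0};t)=0$ for all $t\in I_\epsilon$, then for all $t\in I_\epsilon$ $$\operatorname{sgn}\varphi'(t)=\operatorname{sgn}\operatorname{Re}\bigl(\overline{b_k(t)}\,c_k'(t)\bigr),$$ where $$b_k(t)=-\frac{i\,e^{-i\theta_0}(e^{i\varphi(t)}-e^{i\theta_0})}{Q_n(e^{i\theta_0};t)\,\overline{Q_n(e^{i\varphi(t)};t)}}\int_0^{2\pi}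 e^{-ik\theta}K_n(e^{i\varphi(t)},e^{i\theta};t)\,K_n(e^{i\theta},e^{i\theta_0};t)\frac{d\theta}{2\pi}.$$ -/

import Mathlib

open Polynomial
open scoped ComplexOrder

namespace Popuc

noncomputable section

/-- The `N × N` Toeplitz matrix `(c_{l-j})_{j,l}` of a doubly infinite sequence. -/
def toeplitz (c : ℤ → ℂ) (N : ℕ) : Matrix (Fin N) (Fin N) ℂ :=
  Matrix.of fun j l => c ((l : ℤ) - (j : ℤ))

/-- The matrix, with polynomial entries, whose rows are `(c_0, c_{-1}, …, c_{-n})`,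
`(c_1, c_0, …, c_{1-n})`, …, `(c_{n-1}, …, c_{-1})` and, last, `(1, z, …, z^n)`. -/
def opucMatrix (c : ℤ → ℂ) (n : ℕ) : Matrix (Fin (n + 1)) (Fin (n + 1)) ℂ[X] :=
  Matrix.of fun m l =>
    if (m : ℕ) < n then Polynomial.C (c ((m : ℤ) - (l : ℤ))) else Polynomial.X ^ (l : ℕ)

/-- The monic orthogonal polynomial on the unit circle `Q_n` (for `n = 0` this is `1`). -/
def opuc (c : ℤ → ℂ) (n : ℕ) : ℂ[X] :=
  Polynomial.C (1 / (toeplitz c n).det) * (opucMatrix c n).det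

/-- The reversed polynomial `Q_n^*(z) = z^n conj (Q_n (1 / conj z))`: the coefficient of `z^j` is the
conjugate of the coefficient of `z^(n-j)` in `Q_n`. -/
def opucStar (c : ℤ → ℂ) (n : ℕ) : ℂ[X] :=
  Polynomial.reflect n ((opuc c n).map (starRingEnd ℂ))

/-- The squared norm `∫ |p|^2 dσ`, where `σ` is the measure on the unit circle with moments
`c_j = ∫ e^{-ijθ} dσ(θ)`, so that `∫ z^j conj (z^l) dσ = c_{l-j}`. -/
def sqNorm (c : ℤ → ℂ) (p : ℂ[X]) : ℝ :=
  (∑ j ∈ Finset.range (p.natDegree + 1), ∑ l ∈ Finset.range (p.natDegree + 1),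
    p.coeff j * (starRingEnd ℂ) (p.coeff l) * c ((l : ℤ) - (j : ℤ))).re

/-- The normalized orthogonal polynomial `q_n = κ_n Q_n`, `κ_n = 1 / ‖Q_n‖`. -/
def normalizedOpuc (c : ℤ → ℂ) (n : ℕ) : ℂ[X] :=
  Polynomial.C (((Real.sqrt (sqNorm c (opuc c n)))⁻¹ : ℝ) : ℂ) * opuc c n

/-- The Christoffel–Darboux kernel `K_n(w, z) = ∑_{j ≤ n} conj (q_j w) q_j z`. -/
def cdKernel (c : ℤ → ℂ) (n : ℕ) (w z : ℂ) : ℂ :=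
  ∑ j ∈ Finset.range (n + 1),
    (starRingEnd ℂ) ((normalizedOpuc c j).eval w) * (normalizedOpuc c j).eval z

/-- The monic paraorthogonal polynomial `P_{n+1}(z, b) = z Q_n(z) - conj b Q_n^*(z)`. -/
def popuc (c : ℤ → ℂ) (n : ℕ) (b : ℂ) : ℂ[X] :=
  Polynomial.X * opuc c n - Polynomial.C ((starRingEnd ℂ) b) * opucStar c n

/-- The point `e^{iθ}` of the unit circle. -/
def cis (θ : ℝ) : ℂ := Complex.exp (Complex.I * (θ : ℂ))

/-- The arc `C_δ(ζ₀)`: the points of the unit circle at distance less than `δ` from `ζ₀`. -/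
def arc (ζ₀ : ℂ) (δ : ℝ) : Set ℂ := Metric.ball ζ₀ δ ∩ Metric.sphere (0 : ℂ) 1

/-- The integrand `e^{-ikθ} (sin((θ-φ)/2) / sin((θ+φ)/2)) |K_n(e^{iφ}, e^{iθ})|^2`. -/
def conjIntegrand (c : ℤ → ℂ) (n : ℕ) (k : ℤ) (φ θ : ℝ) : ℂ :=
  cis (-(k : ℝ) * θ) * ((Real.sin ((θ - φ) / 2) / Real.sin ((θ + φ) / 2) : ℝ) : ℂ) *
    ((‖cdKernel c n (cis φ) (cis θ)‖ ^ 2 : ℝ) : ℂ)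

/-- `b_k` for conjugate zeros `e^{iφ}`, `e^{-iφ}`: minus the mean of `conjIntegrand`
with respect to `dθ / 2π`. -/
def bConj (c : ℤ → ℂ) (n : ℕ) (k : ℤ) (φ : ℝ) : ℂ :=
  -((1 / (2 * Real.pi) : ℝ) : ℂ) * ∫ θ in (0 : ℝ)..(2 * Real.pi), conjIntegrand c n k φ θ

/-- The mean `∫ e^{-ikθ} K_n(e^{iφ}, e^{iθ}) K_n(e^{iθ}, e^{iψ}) dθ / 2π`. -/
def kernelMean (c : ℤ → ℂ) (n : ℕ) (k : ℤ) (φ ψ : ℝ) : ℂ :=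
  ((1 / (2 * Real.pi) : ℝ) : ℂ) * ∫ θ in (0 : ℝ)..(2 * Real.pi),
    cis (-(k : ℝ) * θ) * cdKernel c n (cis φ) (cis θ) * cdKernel c n (cis θ) (cis ψ)

/-- `b_k` for a zero `e^{iφ}` and a fixed zero `e^{iθ₀}`. -/
def bFixed (c : ℤ → ℂ) (n : ℕ) (k : ℤ) (θ₀ φ : ℝ) : ℂ :=
  -(Complex.I * cis (-θ₀) * (cis φ - cis θ₀) /
      ((opuc c n).eval (cis θ₀) * (starRingEnd ℂ) ((opuc c n).eval (cis φ)))) *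
    kernelMean c n k φ θ₀

end

end Popuc

/-! Write `P` for the paraorthogonal polynomial and ⟨·,·⟩ for the moment form. Everything rests on
two facts: `P` is orthogonal to `X * g` whenever deg g < n, and multiplication by z preserves ⟨·,·⟩.
If `P` were divisible by (z - a)(z - 1/ā), these would force a nonzero polynomial to have norm zero
(`popuc_not_dvd`). Since the zero set is symmetric in the circle, all zeros lie on it and are
simple, and the implicit function theorem gives the zero curve (`exists_root_curve`).

For the sign of its angular velocity, take two distinct zeros ζ, ω with angular velocities x, y and
write P = (z - ζ)(z - ω)S, R₁ = (z - ω)S, R₂ = (z - ζ)S. Differentiating ⟨P, zS⟩ = 0 in t with S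
frozen gives x‖R₁‖² - y‖R₂‖² = i(1 - ζω̄)⟨R₁, R₂⟩', where the prime means that the moments are
replaced by their derivatives (`variation_identity`). On the circle i(1 - ζω̄)(z - ω)·conj(z - ζ) is
real, so the right side is a positive multiple of Re(β̄ c_k'), with β the same expression for the
unit sequence at -k (`momentForm_phase_conj`, `momentForm_derivative_sequence`).

The kernel K_n(ζ, ·) is a multiple of R₁, and K_n(ω, ·) of R₂ (`cdPoly_eq`), which identifies β with
a positive multiple of the integral defining b_k (`mean_eq_momentForm`, `bFixed_eq`). A fixed second
zero has y = 0 and conjugate zeros have y = -x; either way the left side is x times a positive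
number. Where the two curves meet, simplicity of the zero makes their velocities equal and both
sides of the sign rule vanish. -/

namespace Popuc

open scoped Topology

noncomputable section

/-! ### The moment form -/

/-- The sesquilinear form on polynomials with `⟨z^j, z^l⟩ = c (l - j)`. -/
def momentForm (c : ℤ → ℂ) : ℂ[X] →ₗ[ℂ] ℂ[X] →ₛₗ[starRingEnd ℂ] ℂ :=
  LinearMap.mk₂'ₛₗ (RingHom.id ℂ) (starRingEnd ℂ)
    (fun p q => p.sum fun j a => q.sum fun l b => a * (starRingEnd ℂ) b * c ((l : ℤ) - (j : ℤ)))
    (fun p₁ p₂ q => by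
      rw [sum_add_index]
      · intro i; simp [Polynomial.sum]
      · intro i a b
        simp only [Polynomial.sum, ← Finset.sum_add_distrib]
        exact Finset.sum_congr rfl fun _ _ => by ring)
    (fun r p q => by
      rw [sum_smul_index]
      · simp only [Polynomial.sum, RingHom.id_apply, smul_eq_mul, Finset.mul_sum]
        exact Finset.sum_congr rfl fun _ _ => Finset.sum_congr rfl fun _ _ => by ring
      · intro i; simp [Polynomial.sum])
    (fun p q₁ q₂ => by
      rw [Polynomial.sum_def, Polynomial.sum_def, Polynomial.sum_def, ← Finset.sum_add_distrib]
      refine Finset.sum_congr rfl fun j _ => sum_add_index _ _ _ (fun _ => by simp)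
        (fun _ _ _ => by simp only [map_add]; ring))
    (fun r p q => by
      rw [Polynomial.sum_def, Polynomial.sum_def, smul_eq_mul, Finset.mul_sum]
      refine Finset.sum_congr rfl fun j _ => ?_
      rw [sum_smul_index _ _ _ (fun _ => by simp), Polynomial.sum_def, Polynomial.sum_def,
        Finset.mul_sum]
      exact Finset.sum_congr rfl fun _ _ => by simp only [map_mul]; ring)

theorem momentForm_apply (c : ℤ → ℂ) (p q : ℂ[X]) : momentForm c p q =
    p.sum fun j a => q.sum fun l b => a * (starRingEnd ℂ) b * c ((l : ℤ) - (j : ℤ)) := rfl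

theorem momentForm_eq_sum (c : ℤ → ℂ) {p q : ℂ[X]} {M N : ℕ} (hp : p.natDegree < M)
    (hq : q.natDegree < N) : momentForm c p q = ∑ j ∈ Finset.range M, ∑ l ∈ Finset.range N,
      p.coeff j * (starRingEnd ℂ) (q.coeff l) * c ((l : ℤ) - (j : ℤ)) := by
  rw [momentForm_apply, sum_over_range' p (fun j => by simp [Polynomial.sum]) M hp]
  exact Finset.sum_congr rfl fun j _ => sum_over_range' q (fun l => by simp) N hq

theorem momentForm_X_pow (c : ℤ → ℂ) (j l : ℕ) :
    momentForm c (X ^ j) (X ^ l) = c ((l : ℤ) - (j : ℤ)) := by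
  rw [momentForm_apply, ← monomial_one_right_eq_X_pow, ← monomial_one_right_eq_X_pow,
    sum_monomial_index _ _ (by simp [Polynomial.sum]), sum_monomial_index _ _ (by simp)]
  simp

theorem momentForm_C_mul_left (c : ℤ → ℂ) (a : ℂ) (p q : ℂ[X]) :
    momentForm c (C a * p) q = a * momentForm c p q := by
  rw [← smul_eq_C_mul, map_smul]; rfl

theorem momentForm_C_mul_right (c : ℤ → ℂ) (a : ℂ) (p q : ℂ[X]) :
    momentForm c p (C a * q) = (starRingEnd ℂ) a * momentForm c p q := by
  rw [← smul_eq_C_mul, LinearMap.map_smulₛₗ]; rfl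

/-- This is the Toeplitz structure: shifting both exponents leaves their difference unchanged. -/
theorem momentForm_X_mul_X_mul (c : ℤ → ℂ) (p q : ℂ[X]) :
    momentForm c (X * p) (X * q) = momentForm c p q := by
  induction p using Polynomial.induction_on' with
  | add p₁ p₂ h₁ h₂ => simp only [mul_add, map_add, LinearMap.add_apply, h₁, h₂]
  | monomial j a =>
    induction q using Polynomial.induction_on' with
    | add q₁ q₂ h₁ h₂ => simp only [mul_add, map_add, h₁, h₂]
    | monomial l b =>
      rw [← C_mul_X_pow_eq_monomial, ← C_mul_X_pow_eq_monomial, mul_left_comm, mul_left_comm X,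
        ← pow_succ', ← pow_succ']
      simp only [momentForm_C_mul_left, momentForm_C_mul_right, momentForm_X_pow]
      congr 3
      push_cast
      ring

/-- No Hermitian symmetry of the sequence is assumed, because the unit sequence at a single index is
treated as well. -/
theorem momentForm_conj (c : ℤ → ℂ) (p q : ℂ[X]) : (starRingEnd ℂ) (momentForm c p q) =
    momentForm (fun j => (starRingEnd ℂ) (c (-j))) q p := by
  induction p using Polynomial.induction_on' with
  | add p₁ p₂ h₁ h₂ => simp only [map_add, LinearMap.add_apply, h₁, h₂]
  | monomial j a =>
    induction q using Polynomial.induction_on' with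
    | add q₁ q₂ h₁ h₂ => simp only [map_add, LinearMap.add_apply, h₁, h₂]
    | monomial l b =>
      rw [← C_mul_X_pow_eq_monomial, ← C_mul_X_pow_eq_monomial]
      simp only [momentForm_C_mul_left, momentForm_C_mul_right, momentForm_X_pow, map_mul,
        Complex.conj_conj, neg_sub]
      ring

theorem momentForm_symm {c : ℤ → ℂ} (hc : ∀ j, c (-j) = (starRingEnd ℂ) (c j)) (p q : ℂ[X]) :
    (starRingEnd ℂ) (momentForm c p q) = momentForm c q p := by
  rw [momentForm_conj]
  simp only [hc, Complex.conj_conj]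

theorem momentForm_add (c d : ℤ → ℂ) (p q : ℂ[X]) :
    momentForm (c + d) p q = momentForm c p q + momentForm d p q := by
  simp only [momentForm_apply, Polynomial.sum_def, Pi.add_apply, mul_add, Finset.sum_add_distrib]

theorem momentForm_smul (a : ℂ) (c : ℤ → ℂ) (p q : ℂ[X]) :
    momentForm (a • c) p q = a * momentForm c p q := by
  simp only [momentForm_apply, Polynomial.sum_def, Pi.smul_apply, smul_eq_mul, Finset.mul_sum]
  exact Finset.sum_congr rfl fun _ _ => Finset.sum_congr rfl fun _ _ => by ring

theorem sqNorm_eq (c : ℤ → ℂ) (p : ℂ[X]) : sqNorm c p = (momentForm c p p).re := by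
  rw [momentForm_eq_sum c (Nat.lt_succ_self _) (Nat.lt_succ_self _)]; rfl

theorem momentForm_self_pos {c : ℤ → ℂ} (hc : ∀ N, (toeplitz c N).PosDef) {p : ℂ[X]}
    (hp : p ≠ 0) : 0 < momentForm c p p := by
  have hx : (fun j : Fin (p.natDegree + 1) => (starRingEnd ℂ) (p.coeff j)) ≠ 0 := by
    intro h
    have := congrFun h (Fin.last _)
    simp [hp] at this
  have := (hc (p.natDegree + 1)).dotProduct_mulVec_pos hx
  rw [momentForm_eq_sum c (Nat.lt_succ_self _) (Nat.lt_succ_self _)]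
  convert this using 1
  simp only [dotProduct, Matrix.mulVec, toeplitz, Finset.mul_sum, Pi.star_apply, Finset.sum_range,
    Matrix.of_apply, RCLike.star_def, Complex.conj_conj]
  exact Finset.sum_congr rfl fun _ _ => Finset.sum_congr rfl fun _ _ => by ring

theorem momentForm_self {c : ℤ → ℂ} (hc : ∀ N, (toeplitz c N).PosDef) (p : ℂ[X]) :
    momentForm c p p = (sqNorm c p : ℂ) := by
  rw [sqNorm_eq]
  by_cases hp : p = 0
  · simp [hp]
  · have := momentForm_self_pos hc hp
    rw [Complex.pos_iff] at this
    apply Complex.ext <;> simp [← this.2]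

theorem sqNorm_pos {c : ℤ → ℂ} (hc : ∀ N, (toeplitz c N).PosDef) {p : ℂ[X]}
    (hp : p ≠ 0) : 0 < sqNorm c p := by
  have := momentForm_self_pos hc hp
  rw [momentForm_self hc] at this
  exact_mod_cast this

theorem eq_zero_of_momentForm_self {c : ℤ → ℂ} (hc : ∀ N, (toeplitz c N).PosDef) {p : ℂ[X]}
    (hp : momentForm c p p = 0) : p = 0 := by
  by_contra h
  exact (momentForm_self_pos hc h).ne' hp

/-- For z and ζ on the unit circle, (z - ζ)·conj z = -ζ·conj(z - ζ); this moves a linear factor from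
one argument to the other. -/
theorem momentForm_circle (c : ℤ → ℂ) {ζ : ℂ} (hζ : ζ * (starRingEnd ℂ) ζ = 1) (p q : ℂ[X]) :
    momentForm c ((X - C ζ) * p) (X * q) = -ζ * momentForm c p ((X - C ζ) * q) := by
  simp only [sub_mul, map_sub, LinearMap.sub_apply, momentForm_X_mul_X_mul, momentForm_C_mul_left,
    momentForm_C_mul_right]
  linear_combination (-momentForm c p q) * hζ

/-- A polynomial orthogonal to `r * X ^ m` for `m` in an initial segment is orthogonal to the
multiples of `r` by polynomials of small degree. -/
theorem momentForm_eq_zero_of_degree_lt {c : ℤ → ℂ} {p r : ℂ[X]} {n : ℕ}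
    (h : ∀ m < n, momentForm c p (r * X ^ m) = 0) {g : ℂ[X]} (hg : g.degree < n) :
    momentForm c p (r * g) = 0 := by
  rcases eq_or_ne g 0 with rfl | h0
  · simp
  rw [as_sum_range_C_mul_X_pow' g ((natDegree_lt_iff_degree_lt h0).2 hg), Finset.mul_sum, map_sum]
  refine Finset.sum_eq_zero fun m hm => ?_
  rw [mul_left_comm, momentForm_C_mul_right, h m (Finset.mem_range.1 hm), mul_zero]

/-! ### Orthogonal polynomials from determinants -/

/-- The minor of `opucMatrix` along its last row and the column `l`. -/
def opucMinor (c : ℤ → ℂ) (n : ℕ) (l : Fin (n + 1)) : Matrix (Fin n) (Fin n) ℂ :=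
  Matrix.of fun m j => c ((m : ℤ) - (l.succAbove j : ℤ))

/-- The coefficient of `X ^ l` in `opuc c n`. -/
def opucCoeff (c : ℤ → ℂ) (n : ℕ) (l : Fin (n + 1)) : ℂ :=
  (-1) ^ (n + l : ℕ) * (opucMinor c n l).det / (toeplitz c n).det

theorem opuc_eq_sum (c : ℤ → ℂ) (n : ℕ) :
    opuc c n = ∑ l : Fin (n + 1), C (opucCoeff c n l) * X ^ (l : ℕ) := by
  rw [opuc, Matrix.det_succ_row _ (Fin.last n), Finset.mul_sum]
  refine Finset.sum_congr rfl fun l _ => ?_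
  have : (opucMatrix c n).submatrix (Fin.last n).succAbove l.succAbove =
      (C : ℂ →+* ℂ[X]).mapMatrix (opucMinor c n l) := by
    ext1 m j
    simp [opucMatrix, opucMinor]
  rw [this, ← RingHom.map_det]
  simp only [opucMatrix, opucCoeff, Matrix.of_apply, Fin.val_last, lt_irrefl, if_false, map_mul,
    div_eq_mul_inv, map_pow, map_neg, map_one, one_mul]
  ring

theorem opuc_coeff (c : ℤ → ℂ) (n : ℕ) (l : Fin (n + 1)) :
    (opuc c n).coeff l = opucCoeff c n l := by
  rw [opuc_eq_sum, finsetSum_coeff, Finset.sum_eq_single l]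
  · simp
  · intro j _ hj
    rw [coeff_C_mul_X_pow, if_neg fun h => hj (Fin.ext h.symm)]
  · simp

theorem opuc_natDegree_le (c : ℤ → ℂ) (n : ℕ) : (opuc c n).natDegree ≤ n := by
  rw [opuc_eq_sum]
  exact natDegree_sum_le_of_forall_le _ _ fun l _ =>
    (natDegree_C_mul_X_pow_le _ _).trans (Nat.lt_succ_iff.1 l.2)

theorem opuc_coeff_self {c : ℤ → ℂ} (hc : ∀ N, (toeplitz c N).PosDef) (n : ℕ) :
    (opuc c n).coeff n = 1 := by
  have h := opuc_coeff c n (Fin.last n)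
  rw [Fin.val_last] at h
  have h2 : opucMinor c n (Fin.last n) = (toeplitz c n).transpose := by
    ext m j; simp [opucMinor, toeplitz]
  rw [h, opucCoeff, h2, Matrix.det_transpose, Fin.val_last, ← two_mul, pow_mul]
  simp [(hc n).det_pos.ne']

theorem opuc_monic {c : ℤ → ℂ} (hc : ∀ N, (toeplitz c N).PosDef) (n : ℕ) : (opuc c n).Monic :=
  monic_of_natDegree_le_of_coeff_eq_one n (opuc_natDegree_le c n) (opuc_coeff_self hc n)

theorem opuc_natDegree {c : ℤ → ℂ} (hc : ∀ N, (toeplitz c N).PosDef) (n : ℕ) :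
    (opuc c n).natDegree = n :=
  le_antisymm (opuc_natDegree_le c n) (le_natDegree_of_ne_zero (by simp [opuc_coeff_self hc]))

/-- Pairing with `X ^ m` replaces the last row of the determinant by its row `m`, and a determinant
with two equal rows vanishes. -/
theorem momentForm_opuc_X_pow (c : ℤ → ℂ) {n m : ℕ} (hm : m < n) :
    momentForm c (opuc c n) (X ^ m) = 0 := by
  have h : ((Matrix.of fun i l : Fin (n + 1) => c ((i : ℤ) - (l : ℤ))).updateRow (Fin.last n)
      (fun l => c ((m : ℤ) - (l : ℤ)))).det = 0 :=
    Matrix.det_updateRow_eq_zero (M := Matrix.of fun i l : Fin (n + 1) => c ((i : ℤ) - (l : ℤ)))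
      (i := ⟨m, by omega⟩) (fun h => by simp [Fin.ext_iff] at h; omega)
  rw [Matrix.det_succ_row _ (Fin.last n)] at h
  rw [opuc_eq_sum, map_sum, LinearMap.sum_apply]
  simp only [momentForm_C_mul_left, momentForm_X_pow, opucCoeff]
  rw [← zero_div (toeplitz c n).det, ← h, Finset.sum_div]
  refine Finset.sum_congr rfl fun l _ => ?_
  have : ((Matrix.of fun i l : Fin (n + 1) => c ((i : ℤ) - (l : ℤ))).updateRow (Fin.last n)
      (fun l => c ((m : ℤ) - (l : ℤ)))).submatrix (Fin.last n).succAbove l.succAbove =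
      opucMinor c n l := by
    ext i j
    simp [opucMinor, Matrix.updateRow_apply]
  rw [this]
  simp
  ring

theorem momentForm_opuc_of_degree_lt (c : ℤ → ℂ) {n : ℕ} {g : ℂ[X]} (hg : g.degree < n) :
    momentForm c (opuc c n) g = 0 := by
  rw [← one_mul g]
  refine momentForm_eq_zero_of_degree_lt (fun m hm => ?_) hg
  rw [one_mul, momentForm_opuc_X_pow c hm]

theorem opucStar_coeff (c : ℤ → ℂ) {n j : ℕ} (hj : j ≤ n) :
    (opucStar c n).coeff j = (starRingEnd ℂ) ((opuc c n).coeff (n - j)) := by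
  rw [opucStar, coeff_reflect, revAt_le hj, coeff_map]

theorem opucStar_natDegree_le (c : ℤ → ℂ) (n : ℕ) : (opucStar c n).natDegree ≤ n := by
  rw [natDegree_le_iff_coeff_eq_zero]
  intro j hj
  rw [opucStar, coeff_reflect, revAt_eq_self_of_lt hj, coeff_map,
    coeff_eq_zero_of_natDegree_lt ((opuc_natDegree_le c n).trans_lt hj), map_zero]

/-- Reversal and conjugation of coefficients turn the pairing with z^(m+1) into the conjugate of the
pairing of Q_n with z^(n-m-1). -/
theorem momentForm_opucStar_X_pow {c : ℤ → ℂ} (hc : ∀ j, c (-j) = (starRingEnd ℂ) (c j))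
    {n m : ℕ} (hm : m < n) : momentForm c (opucStar c n) (X ^ (m + 1)) = 0 := by
  have h := congrArg (starRingEnd ℂ) (momentForm_opuc_X_pow c (Nat.sub_lt_of_pos_le (Nat.succ_pos m) hm))
  rw [as_sum_range_C_mul_X_pow' (opuc c n) (Nat.lt_succ_iff.2 (opuc_natDegree_le c n))] at h
  rw [as_sum_range_C_mul_X_pow' (opucStar c n) (Nat.lt_succ_iff.2 (opucStar_natDegree_le c n))]
  simp only [map_sum, LinearMap.sum_apply, momentForm_C_mul_left, momentForm_X_pow, map_mul,
    map_zero] at h ⊢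
  rw [← h, ← Finset.sum_range_reflect]
  refine Finset.sum_congr rfl fun j hj => ?_
  rw [Finset.mem_range] at hj
  rw [opucStar_coeff c (by omega), ← hc]
  congr 2
  · congr 1; omega
  · omega

/-! ### Paraorthogonal polynomials and their zeros -/

theorem popuc_natDegree_le (c : ℤ → ℂ) (n : ℕ) (b : ℂ) : (popuc c n b).natDegree ≤ n + 1 := by
  refine (natDegree_sub_le _ _).trans (max_le ?_ ?_)
  · exact natDegree_mul_le.trans (by have := opuc_natDegree_le c n; simp; omega)
  · exact (natDegree_C_mul_le _ _).trans ((opucStar_natDegree_le c n).trans (by omega))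

theorem popuc_coeff_succ_self {c : ℤ → ℂ} (hc : ∀ N, (toeplitz c N).PosDef) (n : ℕ) (b : ℂ) :
    (popuc c n b).coeff (n + 1) = 1 := by
  rw [popuc, coeff_sub, coeff_X_mul, opuc_coeff_self hc, coeff_C_mul,
    coeff_eq_zero_of_natDegree_lt (Nat.lt_succ_of_le (opucStar_natDegree_le c n))]
  simp

theorem popuc_monic {c : ℤ → ℂ} (hc : ∀ N, (toeplitz c N).PosDef) (n : ℕ) (b : ℂ) :
    (popuc c n b).Monic :=
  monic_of_natDegree_le_of_coeff_eq_one _ (popuc_natDegree_le c n b) (popuc_coeff_succ_self hc n b)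

theorem popuc_natDegree {c : ℤ → ℂ} (hc : ∀ N, (toeplitz c N).PosDef) (n : ℕ) (b : ℂ) :
    (popuc c n b).natDegree = n + 1 :=
  le_antisymm (popuc_natDegree_le c n b)
    (le_natDegree_of_ne_zero (by simp [popuc_coeff_succ_self hc]))

/-- z Q_n is orthogonal to z, …, z^n by the shift invariance, and Q_n^* is orthogonal to the same
powers. -/
theorem momentForm_popuc_X_mul {c : ℤ → ℂ} (hc : ∀ j, c (-j) = (starRingEnd ℂ) (c j)) {n : ℕ}
    (b : ℂ) {g : ℂ[X]} (hg : g.degree < n) : momentForm c (popuc c n b) (X * g) = 0 := by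
  rw [popuc, map_sub, LinearMap.sub_apply, momentForm_X_mul_X_mul,
    momentForm_opuc_of_degree_lt c hg, momentForm_C_mul_left, momentForm_eq_zero_of_degree_lt
      (fun m hm => by rw [← pow_succ', momentForm_opucStar_X_pow hc hm]) hg]
  simp

theorem opucStar_eval (c : ℤ → ℂ) (n : ℕ) {z : ℂ} (hz : z ≠ 0) :
    (opucStar c n).eval z = z ^ n * (starRingEnd ℂ) ((opuc c n).eval ((starRingEnd ℂ) z)⁻¹) := by
  rw [eval_eq_sum_range' (Nat.lt_succ_of_le (opucStar_natDegree_le c n)),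
    eval_eq_sum_range' (Nat.lt_succ_of_le (opuc_natDegree_le c n)), map_sum, Finset.mul_sum,
    ← Finset.sum_range_reflect]
  refine Finset.sum_congr rfl fun j hj => ?_
  have hj' : j ≤ n := Nat.lt_succ_iff.1 (Finset.mem_range.1 hj)
  rw [opucStar_coeff c (by omega), show n - (n + 1 - 1 - j) = j by omega,
    show n + 1 - 1 - j = n - j by omega, pow_sub₀ z hz hj']
  simp
  ring

/-- The zero set of `popuc` is symmetric with respect to the unit circle. -/
theorem popuc_eval_reflection {c : ℤ → ℂ} {n : ℕ} {b : ℂ} (hb : ‖b‖ = 1) {z : ℂ} (hz : z ≠ 0)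
    (h : (popuc c n b).eval z = 0) : (popuc c n b).eval ((starRingEnd ℂ) z)⁻¹ = 0 := by
  have hbb : b * (starRingEnd ℂ) b = 1 := by
    rw [Complex.mul_conj, Complex.normSq_eq_norm_sq, hb]; simp
  set w := ((starRingEnd ℂ) z)⁻¹ with hw
  have hz' : (starRingEnd ℂ) z ≠ 0 := by simpa using hz
  have hzw : w * (starRingEnd ℂ) z = 1 := by rw [hw, inv_mul_cancel₀ hz']
  have h1 := opucStar_eval c n (z := w) (by rw [hw]; exact inv_ne_zero hz')
  rw [hw, map_inv₀, Complex.conj_conj, inv_inv, ← hw] at h1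
  have h2 := congrArg (starRingEnd ℂ) (opucStar_eval c n hz)
  rw [map_mul, map_pow, Complex.conj_conj, ← hw] at h2
  have h3 := congrArg (starRingEnd ℂ) h
  simp only [popuc, eval_sub, eval_mul, eval_X, eval_C, map_sub, map_mul, map_zero,
    Complex.conj_conj, h2] at h3 ⊢
  rw [h1]
  have h4 : w ^ n * (starRingEnd ℂ) z ^ n = 1 := by rw [← mul_pow, hzw, one_pow]
  linear_combination (-w ^ (n + 1) * (starRingEnd ℂ) b) * h3
    + w ^ n * (starRingEnd ℂ) ((opuc c n).eval z) * (starRingEnd ℂ) b * hzw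
    + (eval w (opuc c n)) * w * (0 - b * (starRingEnd ℂ) b) * h4
    - (eval w (opuc c n)) * w * hbb

theorem popuc_eval_zero_ne {c : ℤ → ℂ} (hc : ∀ N, (toeplitz c N).PosDef) {n : ℕ} {b : ℂ}
    (hb : ‖b‖ = 1) : (popuc c n b).eval 0 ≠ 0 := by
  have h : (opucStar c n).eval 0 = 1 := by
    rw [← coeff_zero_eq_eval_zero, opucStar_coeff c (Nat.zero_le n), Nat.sub_zero,
      opuc_coeff_self hc, map_one]
  have hb0 : b ≠ 0 := fun h => by simp [h] at hb
  simp [popuc, h, hb0]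

/-- With quotient S, the squared norm of (z - a)S equals -ā⟨P, zS⟩, which is zero by orthogonality.
One statement serves twice: for a off the circle it excludes a reflected pair of zeros, for a on the
circle a double zero. -/
theorem popuc_not_dvd {c : ℤ → ℂ} (hh : ∀ j, c (-j) = (starRingEnd ℂ) (c j))
    (hc : ∀ N, (toeplitz c N).PosDef) {n : ℕ} {b z : ℂ} (hz : z ≠ 0) :
    ¬ (X - C z) * (X - C ((starRingEnd ℂ) z)⁻¹) ∣ popuc c n b := by
  rintro ⟨S, hS⟩
  have hS0 : S ≠ 0 := by
    rintro rfl
    exact (popuc_monic hc n b).ne_zero (by rw [hS, mul_zero])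
  have hdeg : S.degree < n := by
    rw [← natDegree_lt_iff_degree_lt hS0]
    have := popuc_natDegree hc n b
    rw [hS, Monic.natDegree_mul' ((monic_X_sub_C _).mul (monic_X_sub_C _)) hS0,
      Monic.natDegree_mul (monic_X_sub_C _) (monic_X_sub_C _), natDegree_X_sub_C,
      natDegree_X_sub_C] at this
    omega
  have h := momentForm_popuc_X_mul hh b hdeg
  have hz' : (starRingEnd ℂ) z ≠ 0 := by simpa using hz
  have key : momentForm c ((X - C z) * S) ((X - C z) * S) =
      -(starRingEnd ℂ) z * momentForm c (popuc c n b) (X * S) := by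
    rw [hS]
    have : (X - C z) * (X - C ((starRingEnd ℂ) z)⁻¹) * S =
      X * (X * S) - C z * (X * S) - C ((starRingEnd ℂ) z)⁻¹ * (X * S)
        + C z * (C ((starRingEnd ℂ) z)⁻¹ * S) := by ring
    rw [this]
    simp only [sub_mul, map_sub, map_add, LinearMap.sub_apply, LinearMap.add_apply,
      momentForm_X_mul_X_mul, momentForm_C_mul_left, momentForm_C_mul_right]
    field_simp
    ring
  rw [h, mul_zero] at key
  exact mul_ne_zero (X_sub_C_ne_zero z) hS0 (eq_zero_of_momentForm_self hc key)

theorem popuc_root_ne_zero {c : ℤ → ℂ} (hc : ∀ N, (toeplitz c N).PosDef) {n : ℕ} {b : ℂ}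
    (hb : ‖b‖ = 1) {z : ℂ} (h : (popuc c n b).eval z = 0) : z ≠ 0 := by
  rintro rfl
  exact popuc_eval_zero_ne hc hb h

theorem popuc_root_conj_inv {c : ℤ → ℂ} (hh : ∀ j, c (-j) = (starRingEnd ℂ) (c j))
    (hc : ∀ N, (toeplitz c N).PosDef) {n : ℕ} {b : ℂ} (hb : ‖b‖ = 1) {z : ℂ}
    (h : (popuc c n b).eval z = 0) : ((starRingEnd ℂ) z)⁻¹ = z := by
  have hz := popuc_root_ne_zero hc hb h
  by_contra hne
  refine popuc_not_dvd hh hc (b := b) (n := n) hz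
    (IsCoprime.mul_dvd ?_ (dvd_iff_isRoot.2 h)
      (dvd_iff_isRoot.2 (popuc_eval_reflection hb hz h)))
  exact isCoprime_X_sub_C_of_isUnit_sub (sub_ne_zero.2 (Ne.symm hne)).isUnit

/-- The zeros of a paraorthogonal polynomial lie on the unit circle. -/
theorem popuc_root_mul_conj {c : ℤ → ℂ} (hh : ∀ j, c (-j) = (starRingEnd ℂ) (c j))
    (hc : ∀ N, (toeplitz c N).PosDef) {n : ℕ} {b : ℂ} (hb : ‖b‖ = 1) {z : ℂ}
    (h : (popuc c n b).eval z = 0) : z * (starRingEnd ℂ) z = 1 := by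
  have := popuc_root_conj_inv hh hc hb h
  nth_rewrite 1 [← this]
  exact inv_mul_cancel₀ (by simpa using popuc_root_ne_zero hc hb h)

/-- The zeros of a paraorthogonal polynomial are simple. -/
theorem popuc_derivative_ne_zero {c : ℤ → ℂ} (hh : ∀ j, c (-j) = (starRingEnd ℂ) (c j))
    (hc : ∀ N, (toeplitz c N).PosDef) {n : ℕ} {b : ℂ} (hb : ‖b‖ = 1) {z : ℂ}
    (h : (popuc c n b).eval z = 0) : (derivative (popuc c n b)).eval z ≠ 0 := by
  intro h'
  refine popuc_not_dvd hh hc (b := b) (n := n) (popuc_root_ne_zero hc hb h) ?_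
  -- A zero is its own reflection, so the excluded divisor is the square of the linear factor.
  rw [popuc_root_conj_inv hh hc hb h]
  obtain ⟨R, hR⟩ := dvd_iff_isRoot.2 h
  rw [hR, derivative_mul] at h'
  simp only [derivative_sub, derivative_X, derivative_C, eval_add, eval_mul, eval_sub, eval_X,
    eval_C, sub_self, zero_mul, add_zero, sub_zero, one_mul] at h'
  rw [hR]
  exact mul_dvd_mul_left _ (dvd_iff_isRoot.2 h')

/-! ### Nonvanishing on the circle and cofactors of zeros -/

theorem opuc_ne_zero {c : ℤ → ℂ} (hc : ∀ N, (toeplitz c N).PosDef) (n : ℕ) : opuc c n ≠ 0 :=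
  (opuc_monic hc n).ne_zero

/-- By `momentForm_circle`, the squared norm of (X - z)h is a combination of ⟨h, (X - z)h⟩ and its
conjugate, hence zero. -/
theorem eq_zero_of_momentForm_X_sub_C_mul {c : ℤ → ℂ}
    (hh : ∀ j, c (-j) = (starRingEnd ℂ) (c j)) (hc : ∀ N, (toeplitz c N).PosDef) {z : ℂ}
    (hz : z * (starRingEnd ℂ) z = 1) {h : ℂ[X]} (h0 : momentForm c h ((X - C z) * h) = 0) :
    h = 0 := by
  have h3 : momentForm c ((X - C z) * h) ((X - C z) * h) = 0 := by
    have h4 := momentForm_circle c hz h h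
    rw [h0, mul_zero] at h4
    have : (X - C z) * h = X * h - C z * h := by ring
    nth_rewrite 2 [this]
    rw [map_sub, h4, momentForm_C_mul_right, ← momentForm_symm hh, h0]
    simp
  exact (mul_eq_zero.1 (eq_zero_of_momentForm_self hc h3)).resolve_left (X_sub_C_ne_zero z)

/-- Orthogonal polynomials do not vanish on the unit circle. -/
theorem opuc_eval_ne_zero {c : ℤ → ℂ} (hh : ∀ j, c (-j) = (starRingEnd ℂ) (c j))
    (hc : ∀ N, (toeplitz c N).PosDef) (n : ℕ) {z : ℂ}
    (hz : z * (starRingEnd ℂ) z = 1) : (opuc c n).eval z ≠ 0 := by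
  intro h
  obtain ⟨g, hg⟩ := dvd_iff_isRoot.2 h
  have hg0 : g ≠ 0 := by rintro rfl; exact opuc_ne_zero hc n (by rw [hg, mul_zero])
  have hdeg : g.degree < n := by
    rw [← natDegree_lt_iff_degree_lt hg0, ← opuc_natDegree hc n, hg,
      Monic.natDegree_mul' (monic_X_sub_C _) hg0, natDegree_X_sub_C]
    omega
  refine hg0 (eq_zero_of_momentForm_X_sub_C_mul hh hc hz ?_)
  rw [← hg, ← momentForm_symm hh, momentForm_opuc_of_degree_lt c hdeg, map_zero]

/-- The cofactor of a zero of `popuc` is orthogonal to the polynomials vanishing at that zero. -/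
theorem momentForm_cofactor {c : ℤ → ℂ} (hh : ∀ j, c (-j) = (starRingEnd ℂ) (c j)) {n : ℕ}
    {b z : ℂ} (hz : z * (starRingEnd ℂ) z = 1) {R : ℂ[X]} (hR : popuc c n b = (X - C z) * R)
    {g : ℂ[X]} (hg : g.degree < n) : momentForm c R ((X - C z) * g) = 0 := by
  have h := momentForm_popuc_X_mul hh b hg
  rw [hR, momentForm_circle c hz] at h
  refine (mul_eq_zero.1 h).resolve_left (neg_ne_zero.2 ?_)
  rintro rfl
  simp at hz

/-! ### The Christoffel–Darboux kernel -/

theorem normalizedOpuc_eval (c : ℤ → ℂ) (n : ℕ) (z : ℂ) : (normalizedOpuc c n).eval z =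
    (((Real.sqrt (sqNorm c (opuc c n)))⁻¹ : ℝ) : ℂ) * (opuc c n).eval z := by
  rw [normalizedOpuc, eval_mul, eval_C]

/-- The Christoffel–Darboux kernel as a polynomial in its second argument. -/
def cdPoly (c : ℤ → ℂ) (n : ℕ) (w : ℂ) : ℂ[X] :=
  ∑ j ∈ Finset.range (n + 1), C ((starRingEnd ℂ) ((normalizedOpuc c j).eval w)) * normalizedOpuc c j

theorem cdPoly_eval (c : ℤ → ℂ) (n : ℕ) (w z : ℂ) : (cdPoly c n w).eval z = cdKernel c n w z := by
  simp [cdPoly, cdKernel, eval_finsetSum]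

theorem cdKernel_conj (c : ℤ → ℂ) (n : ℕ) (w z : ℂ) :
    (starRingEnd ℂ) (cdKernel c n w z) = cdKernel c n z w := by
  simp [cdKernel, mul_comm]

theorem momentForm_opuc_cdPoly {c : ℤ → ℂ} (hh : ∀ j, c (-j) = (starRingEnd ℂ) (c j))
    (hc : ∀ N, (toeplitz c N).PosDef) {n m : ℕ} (hm : m ≤ n) (w : ℂ) :
    momentForm c (opuc c m) (cdPoly c n w) = (opuc c m).eval w := by
  rw [cdPoly, map_sum, Finset.sum_eq_single m]
  · have h := sqNorm_pos hc (opuc_ne_zero hc m)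
    rw [normalizedOpuc_eval, normalizedOpuc, momentForm_C_mul_right, momentForm_C_mul_right,
      momentForm_self hc, map_mul, map_mul, Complex.conj_conj, Complex.conj_conj,
      Complex.conj_ofReal]
    have h2 : (((Real.sqrt (sqNorm c (opuc c m)))⁻¹ : ℝ) : ℂ) *
      (((Real.sqrt (sqNorm c (opuc c m)))⁻¹ : ℝ) : ℂ) * (sqNorm c (opuc c m) : ℂ) = 1 := by
      norm_cast
      rw [← mul_inv, Real.mul_self_sqrt h.le, inv_mul_cancel₀ h.ne']
    linear_combination (eval w (opuc c m)) * h2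
  · intro j _ hj
    rw [normalizedOpuc, momentForm_C_mul_right, momentForm_C_mul_right]
    rcases lt_or_gt_of_ne hj with h | h
    · rw [momentForm_opuc_of_degree_lt c, mul_zero, mul_zero]
      rw [← natDegree_lt_iff_degree_lt (opuc_ne_zero hc j), opuc_natDegree hc]; exact h
    · rw [← momentForm_symm hh, momentForm_opuc_of_degree_lt c, map_zero, mul_zero, mul_zero]
      rw [← natDegree_lt_iff_degree_lt (opuc_ne_zero hc m), opuc_natDegree hc]; exact h
  · intro h; exact absurd (Finset.mem_range.2 (Nat.lt_succ_of_le hm)) h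

/-- The reproducing property of the Christoffel–Darboux kernel. -/
theorem momentForm_cdPoly {c : ℤ → ℂ} (hh : ∀ j, c (-j) = (starRingEnd ℂ) (c j))
    (hc : ∀ N, (toeplitz c N).PosDef) {n : ℕ} (w : ℂ) {f : ℂ[X]} (hf : f.natDegree ≤ n) :
    momentForm c f (cdPoly c n w) = f.eval w := by
  suffices H : ∀ m ≤ n + 1, ∀ f : ℂ[X], f.degree < m →
      momentForm c f (cdPoly c n w) = f.eval w by
    refine H (n + 1) le_rfl f (degree_le_natDegree.trans_lt ?_)
    exact_mod_cast Nat.lt_succ_of_le hf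
  intro m
  induction m with
  | zero => 
    intro _ f hf
    have : f = 0 := by simpa [degree_lt_iff_coeff_zero, Polynomial.ext_iff] using hf
    simp [this]
  | succ m ih =>
    intro hm f hf
    -- Since Q_m is monic, subtracting its multiple by the coefficient of z^m lowers the degree
    -- bound.
    have h := ih (by omega) (f - C (f.coeff m) * opuc c m) ?_
    · rw [map_sub, LinearMap.sub_apply, momentForm_C_mul_left,
        momentForm_opuc_cdPoly hh hc (by omega), eval_sub, eval_mul, eval_C] at h
      simpa using h
    · rw [degree_lt_iff_coeff_zero] at hf ⊢
      intro j hj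
      rcases hj.eq_or_lt with rfl | hj
      · simp [opuc_coeff_self hc]
      · rw [coeff_sub, coeff_C_mul, hf j hj, coeff_eq_zero_of_natDegree_lt (p := opuc c m) (by
          rw [opuc_natDegree hc]; exact hj)]
        simp

theorem cdPoly_natDegree_le {c : ℤ → ℂ} (hc : ∀ N, (toeplitz c N).PosDef) (n : ℕ) (w : ℂ) :
    (cdPoly c n w).natDegree ≤ n := by
  refine natDegree_sum_le_of_forall_le _ _ fun j hj => ?_
  refine (natDegree_C_mul_le _ _).trans ((natDegree_C_mul_le _ _).trans ?_)
  rw [opuc_natDegree hc]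
  exact Nat.lt_succ_iff.1 (Finset.mem_range.1 hj)

theorem cdPoly_coeff {c : ℤ → ℂ} (hc : ∀ N, (toeplitz c N).PosDef) (n : ℕ) (w : ℂ) :
    (cdPoly c n w).coeff n =
      (starRingEnd ℂ) ((opuc c n).eval w) / (sqNorm c (opuc c n) : ℂ) := by
  have h := sqNorm_pos hc (opuc_ne_zero hc n)
  rw [cdPoly, finsetSum_coeff, Finset.sum_range_succ, Finset.sum_eq_zero, zero_add, coeff_C_mul,
    normalizedOpuc_eval, normalizedOpuc, coeff_C_mul, opuc_coeff_self hc, map_mul,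
    Complex.conj_ofReal, eq_div_iff (by exact_mod_cast h.ne')]
  · have h2 : (((Real.sqrt (sqNorm c (opuc c n)))⁻¹ : ℝ) : ℂ) *
      (((Real.sqrt (sqNorm c (opuc c n)))⁻¹ : ℝ) : ℂ) * (sqNorm c (opuc c n) : ℂ) = 1 := by
      norm_cast
      rw [← mul_inv, Real.mul_self_sqrt h.le, inv_mul_cancel₀ h.ne']
    linear_combination ((starRingEnd ℂ) (eval w (opuc c n))) * h2
  · intro j hj
    rw [coeff_C_mul, normalizedOpuc, coeff_C_mul, coeff_eq_zero_of_natDegree_lt (by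
      rw [opuc_natDegree hc]; exact Finset.mem_range.1 hj)]
    simp

/-- Both K_n(z, ·) and the cofactor R are orthogonal to all (X - z)g with deg g < n, the first by
reproduction. Matching the coefficients of X^n leaves a difference h of degree below n, itself an
admissible g, so h = 0. This replaces the Christoffel–Darboux formula. -/
theorem cdPoly_eq {c : ℤ → ℂ} (hh : ∀ j, c (-j) = (starRingEnd ℂ) (c j))
    (hc : ∀ N, (toeplitz c N).PosDef) {n : ℕ} {b z : ℂ} (hz : z * (starRingEnd ℂ) z = 1)
    {R : ℂ[X]} (hR : popuc c n b = (X - C z) * R) :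
    cdPoly c n z = C ((starRingEnd ℂ) ((opuc c n).eval z) / (sqNorm c (opuc c n) : ℂ)) * R := by
  have hR0 : R ≠ 0 := by rintro rfl; exact (popuc_monic hc n b).ne_zero (by rw [hR, mul_zero])
  have hRdeg : R.natDegree = n := by
    have := popuc_natDegree hc n b
    rw [hR, Monic.natDegree_mul' (monic_X_sub_C _) hR0, natDegree_X_sub_C] at this
    omega
  have hRm : R.coeff n = 1 := by
    have := popuc_monic hc n b
    rw [hR] at this
    have := (monic_X_sub_C z).of_mul_monic_left this
    rw [Monic, leadingCoeff, hRdeg] at this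
    exact this
  set a := (starRingEnd ℂ) ((opuc c n).eval z) / (sqNorm c (opuc c n) : ℂ)
  set h := cdPoly c n z - C a * R with hdef
  have hdeg : h.degree < n := by
    rw [degree_lt_iff_coeff_zero]
    intro j hj
    rcases hj.eq_or_lt with rfl | hj
    · rw [coeff_sub, coeff_C_mul, cdPoly_coeff hc, hRm, mul_one, sub_self]
    · rw [coeff_sub, coeff_C_mul, coeff_eq_zero_of_natDegree_lt
        ((cdPoly_natDegree_le hc n z).trans_lt hj),
        coeff_eq_zero_of_natDegree_lt (hRdeg.trans_lt hj)]
      simp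
  have horth : momentForm c h ((X - C z) * h) = 0 := by
    have h1 := momentForm_cofactor hh hz hR hdeg
    have h2 : momentForm c (cdPoly c n z) ((X - C z) * h) = 0 := by
      rw [← momentForm_symm hh, momentForm_cdPoly hh hc]
      · simp
      · by_cases h0 : h = 0
        · simp [h0]
        · have := (natDegree_lt_iff_degree_lt h0).2 hdeg
          rw [Monic.natDegree_mul' (monic_X_sub_C _) h0, natDegree_X_sub_C]
          omega
    rw [hdef, map_sub, LinearMap.sub_apply, ← hdef, h2, momentForm_C_mul_left, h1, mul_zero,
      sub_zero]
  exact sub_eq_zero.1 (eq_zero_of_momentForm_X_sub_C_mul hh hc hz horth)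

/-! ### Means over the circle as moment forms -/

theorem cis_add (x y : ℝ) : cis (x + y) = cis x * cis y := by
  rw [cis, cis, cis, ← Complex.exp_add]; push_cast; ring_nf

theorem cis_conj (x : ℝ) : (starRingEnd ℂ) (cis x) = cis (-x) := by
  rw [cis, cis, ← Complex.exp_conj]; simp

theorem cis_mul_neg (x : ℝ) : cis x * cis (-x) = 1 := by
  rw [← cis_add]; simp [cis]

theorem cis_mul_conj (x : ℝ) : cis x * (starRingEnd ℂ) (cis x) = 1 := by
  rw [cis_conj, cis_mul_neg]

theorem cis_ne_zero (x : ℝ) : cis x ≠ 0 := Complex.exp_ne_zero _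

theorem continuous_cis : Continuous cis := by unfold cis; fun_prop

theorem cis_eq (x : ℝ) : cis x = Real.cos x + Real.sin x * Complex.I := by
  rw [cis, mul_comm, Complex.exp_mul_I]; simp

theorem cis_nat_mul (m : ℕ) (x : ℝ) : cis (m * x) = cis x ^ m := by
  rw [cis, cis, ← Complex.exp_nat_mul]; push_cast; ring_nf

theorem hasDerivAt_cis {φ : ℝ → ℝ} {φ' t : ℝ} (h : HasDerivAt φ φ' t) :
    HasDerivAt (fun s => cis (φ s)) (Complex.I * φ' * cis (φ t)) t := by
  have := (h.ofReal_comp.const_mul Complex.I).cexp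
  rw [mul_comm] at this
  exact this

theorem integral_cis (m : ℤ) : ((1 / (2 * Real.pi) : ℝ) : ℂ) *
    ∫ θ in (0 : ℝ)..(2 * Real.pi), cis (m * θ) = if m = 0 then 1 else 0 := by
  have hpi : (Real.pi : ℂ) ≠ 0 := by exact_mod_cast Real.pi_ne_zero
  split_ifs with h
  · subst h
    simp [cis]
    field_simp
  · have : ∀ θ : ℝ, cis (m * θ) = Complex.exp ((Complex.I * m) * θ) := by
      intro θ; rw [cis]; push_cast; ring_nf
    simp only [this]
    rw [integral_exp_mul_complex (mul_ne_zero Complex.I_ne_zero (by exact_mod_cast h))]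
    have h2 : Complex.I * m * ((2 * Real.pi : ℝ) : ℂ) = m * (2 * Real.pi * Complex.I) := by
      push_cast; ring
    rw [h2, Complex.exp_int_mul_two_pi_mul_I]
    simp

/-- Trigonometric moments of `p * conj q` as values of the moment form of a unit sequence. -/
theorem mean_eq_momentForm (k : ℤ) (p q : ℂ[X]) : ((1 / (2 * Real.pi) : ℝ) : ℂ) *
    ∫ θ in (0 : ℝ)..(2 * Real.pi),
      cis (-(k : ℝ) * θ) * (p.eval (cis θ) * (starRingEnd ℂ) (q.eval (cis θ))) =
    momentForm (Pi.single (-k) 1) p q := by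
  have hcont : ∀ p q : ℂ[X], IntervalIntegrable (fun θ : ℝ => cis (-(k : ℝ) * θ) *
      (p.eval (cis θ) * (starRingEnd ℂ) (q.eval (cis θ)))) MeasureTheory.volume
      0 (2 * Real.pi) := by
    intro p q
    refine Continuous.intervalIntegrable ?_ _ _
    have h1 := continuous_cis
    have h2 : ∀ p : ℂ[X], Continuous fun θ : ℝ => p.eval (cis θ) :=
      fun p => p.continuous.comp h1
    exact (h1.comp (by fun_prop)).mul ((h2 p).mul (Complex.continuous_conj.comp (h2 q)))
  induction p using Polynomial.induction_on' with
  | add p₁ p₂ h₁ h₂ =>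
    simp only [eval_add, map_add, LinearMap.add_apply, ← h₁, ← h₂, add_mul, mul_add]
    rw [intervalIntegral.integral_add (hcont _ _) (hcont _ _), mul_add]
  | monomial j a =>
    induction q using Polynomial.induction_on' with
    | add q₁ q₂ h₁ h₂ =>
      simp only [eval_add, map_add, ← h₁, ← h₂, mul_add]
      rw [intervalIntegral.integral_add (hcont _ _) (hcont _ _), mul_add]
    | monomial l b =>
      have h1 : ∀ θ : ℝ, cis (-(k : ℝ) * θ) * ((monomial j a).eval (cis θ) *
          (starRingEnd ℂ) ((monomial l b).eval (cis θ))) =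
          (a * (starRingEnd ℂ) b) * cis (((j - l - k : ℤ) : ℝ) * θ) := by
        intro θ
        rw [eval_monomial, eval_monomial, map_mul, map_pow, cis_conj, ← cis_nat_mul,
          ← cis_nat_mul, show ((j - l - k : ℤ) : ℝ) * θ = -(k : ℝ) * θ + j * θ + l * (-θ) by
            push_cast; ring, cis_add, cis_add]
        ring
      simp only [h1]
      rw [intervalIntegral.integral_const_mul, mul_left_comm, integral_cis,
        ← C_mul_X_pow_eq_monomial, ← C_mul_X_pow_eq_monomial, momentForm_C_mul_left,
        momentForm_C_mul_right, momentForm_X_pow, Pi.single_apply, mul_assoc]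
      -- The form evaluates the sequence at l - j while the mean survives for j - l = k; hence the
      -- unit mass at -k.
      congr 3
      apply propext
      omega

theorem kernelMean_eq {c : ℤ → ℂ} (hh : ∀ j, c (-j) = (starRingEnd ℂ) (c j))
    (hc : ∀ N, (toeplitz c N).PosDef) {n : ℕ} {b : ℂ} (k : ℤ) {φ ψ : ℝ} {R₁ R₂ : ℂ[X]}
    (h₁ : popuc c n b = (X - C (cis φ)) * R₁) (h₂ : popuc c n b = (X - C (cis ψ)) * R₂) :
    kernelMean c n k φ ψ = (starRingEnd ℂ) ((opuc c n).eval (cis φ)) * (opuc c n).eval (cis ψ) /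
      (sqNorm c (opuc c n) : ℂ) ^ 2 * momentForm (Pi.single (-k) 1) R₁ R₂ := by
  have h : ∀ θ : ℝ, cis (-(k : ℝ) * θ) * cdKernel c n (cis φ) (cis θ) *
      cdKernel c n (cis θ) (cis ψ) =
      (starRingEnd ℂ) ((opuc c n).eval (cis φ)) * (opuc c n).eval (cis ψ) /
        (sqNorm c (opuc c n) : ℂ) ^ 2 *
      (cis (-(k : ℝ) * θ) * (R₁.eval (cis θ) * (starRingEnd ℂ) (R₂.eval (cis θ)))) := by
    intro θ
    rw [← cdKernel_conj c n (cis ψ), ← cdPoly_eval, ← cdPoly_eval,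
      cdPoly_eq hh hc (cis_mul_conj _) h₁, cdPoly_eq hh hc (cis_mul_conj _) h₂]
    simp only [eval_mul, eval_C, map_mul, map_div₀, Complex.conj_conj, Complex.conj_ofReal]
    ring
  simp only [kernelMean, h]
  rw [← mean_eq_momentForm, intervalIntegral.integral_const_mul]
  ring

/-! ### The sine quotient and the two formulas for b_k -/

theorem cis_sub_cis (x y : ℝ) : cis x - cis y =
    2 * Complex.I * Real.sin ((x - y) / 2) * cis ((x + y) / 2) := by
  have h1 : cis x = cis ((x + y) / 2) * cis ((x - y) / 2) := by rw [← cis_add]; ring_nf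
  have h2 : cis y = cis ((x + y) / 2) * cis (-((x - y) / 2)) := by rw [← cis_add]; ring_nf
  rw [h1, h2, cis_eq ((x - y) / 2), cis_eq (-((x - y) / 2)), Real.cos_neg, Real.sin_neg]
  push_cast
  ring

/-- By half-angle factorization the sine quotient equals e^{iφ} times the conjugate of (e^{iθ} -
e^{iφ})/(e^{iθ} - e^{-iφ}), exactly the factor that exchanges the cofactors of the two zeros. -/
theorem sin_div_sin_mul {φ θ : ℝ} (h : cis θ ≠ cis (-φ)) :
    ((Real.sin ((θ - φ) / 2) / Real.sin ((θ + φ) / 2) : ℝ) : ℂ) *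
      (starRingEnd ℂ) (cis θ - cis (-φ)) = cis φ * (starRingEnd ℂ) (cis θ - cis φ) := by
  rw [cis_sub_cis, cis_sub_cis, sub_neg_eq_add]
  simp only [map_mul, Complex.conj_ofReal, Complex.conj_I, cis_conj, map_ofNat]
  have h0 : (Real.sin ((θ + φ) / 2) : ℂ) ≠ 0 := by
    intro h0
    apply h
    rw [← sub_eq_zero, cis_sub_cis, sub_neg_eq_add, h0]
    ring
  have h1 : cis (-((θ + -φ) / 2)) = cis φ * cis (-((θ + φ) / 2)) := by
    rw [← cis_add]; ring_nf
  rw [h1]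
  push_cast at h0 ⊢
  field_simp

theorem conjIntegrand_eq {c : ℤ → ℂ} (hh : ∀ j, c (-j) = (starRingEnd ℂ) (c j))
    (hc : ∀ N, (toeplitz c N).PosDef) {n : ℕ} {b : ℂ} (k : ℤ) {φ θ : ℝ}
    (h₁ : (popuc c n b).eval (cis φ) = 0) (h₂ : (popuc c n b).eval (cis (-φ)) = 0)
    (h : cis θ ≠ cis (-φ)) :
    conjIntegrand c n k φ θ = cis φ * ((‖(opuc c n).eval (cis φ)‖ ^ 2 : ℝ) : ℂ) /
        ((opuc c n).eval (cis (-φ)) * (starRingEnd ℂ) ((opuc c n).eval (cis φ))) *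
      (cis (-(k : ℝ) * θ) * cdKernel c n (cis φ) (cis θ) *
        cdKernel c n (cis θ) (cis (-φ))) := by
  obtain ⟨R₁, hR₁⟩ := dvd_iff_isRoot.2 h₁
  obtain ⟨R₂, hR₂⟩ := dvd_iff_isRoot.2 h₂
  have e := congrArg (fun p => (starRingEnd ℂ) (p.eval (cis θ))) (hR₁.symm.trans hR₂)
  simp only [eval_mul, eval_sub, eval_X, eval_C, map_mul] at e
  have hQ₁ := opuc_eval_ne_zero hh hc n (cis_mul_conj φ)
  have hQ₂ := opuc_eval_ne_zero hh hc n (cis_mul_conj (-φ))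
  have hQ₁' : (starRingEnd ℂ) ((opuc c n).eval (cis φ)) ≠ 0 := by simpa using hQ₁
  have s := sin_div_sin_mul h
  have hne : (starRingEnd ℂ) (cis θ - cis (-φ)) ≠ 0 := by
    rw [Ne, map_eq_zero_iff _ (starRingEnd ℂ).injective, sub_eq_zero]
    exact h
  have hN : (sqNorm c (opuc c n) : ℂ) ≠ 0 := by
    exact_mod_cast (sqNorm_pos hc (opuc_ne_zero hc n)).ne'
  rw [conjIntegrand, ← Complex.normSq_eq_norm_sq, ← Complex.normSq_eq_norm_sq,
    ← Complex.mul_conj, ← Complex.mul_conj, ← cdKernel_conj c n (cis (-φ)), ← cdPoly_eval,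
    ← cdPoly_eval, cdPoly_eq hh hc (cis_mul_conj _) hR₁, cdPoly_eq hh hc (cis_mul_conj _) hR₂]
  simp only [eval_mul, eval_C, map_mul, map_div₀, Complex.conj_conj, Complex.conj_ofReal]
  set w := cis (-(k : ℝ) * θ)
  field_simp
  apply mul_right_cancel₀ hne
  linear_combination (w * eval (cis θ) R₁ * (starRingEnd ℂ) (eval (cis θ) R₁)) * s +
    (w * eval (cis θ) R₁ * cis φ) * e

/-- The equality may fail only where the sine in the denominator vanishes and the quotient takes the
default value 0; these θ form a countable set. -/
theorem conjIntegrand_ae_eq {c : ℤ → ℂ} (hh : ∀ j, c (-j) = (starRingEnd ℂ) (c j))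
    (hc : ∀ N, (toeplitz c N).PosDef) {n : ℕ} {b : ℂ} (k : ℤ) {φ : ℝ}
    (h₁ : (popuc c n b).eval (cis φ) = 0) (h₂ : (popuc c n b).eval (cis (-φ)) = 0) :
    conjIntegrand c n k φ =ᵐ[MeasureTheory.volume] fun θ =>
      cis φ * ((‖(opuc c n).eval (cis φ)‖ ^ 2 : ℝ) : ℂ) /
        ((opuc c n).eval (cis (-φ)) * (starRingEnd ℂ) ((opuc c n).eval (cis φ))) *
      (cis (-(k : ℝ) * θ) * cdKernel c n (cis φ) (cis θ) *
        cdKernel c n (cis θ) (cis (-φ))) := by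
  have hcount : {θ : ℝ | cis θ = cis (-φ)}.Countable := by
    refine (Set.countable_range fun m : ℤ => -φ + m * (2 * Real.pi)).mono ?_
    intro θ (hθ : cis θ = cis (-φ))
    rw [cis, cis, Complex.exp_eq_exp_iff_exists_int] at hθ
    obtain ⟨m, hm⟩ := hθ
    refine ⟨m, ?_⟩
    have h2 : Complex.I * (θ : ℂ) = Complex.I * ((-φ + m * (2 * Real.pi) : ℝ) : ℂ) := by
      rw [hm]; push_cast; ring
    exact_mod_cast (mul_left_cancel₀ Complex.I_ne_zero h2).symm
  have := hcount.ae_notMem MeasureTheory.volume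
  filter_upwards [this] with θ hθ
  exact conjIntegrand_eq hh hc k h₁ h₂ hθ

theorem continuous_kernel_product (c : ℤ → ℂ) (n : ℕ) (k : ℤ) (φ ψ : ℝ) :
    Continuous fun θ : ℝ => cis (-(k : ℝ) * θ) * cdKernel c n (cis φ) (cis θ) *
      cdKernel c n (cis θ) (cis ψ) := by
  have h1 := continuous_cis
  have h2 : ∀ x : ℝ, Continuous fun θ : ℝ => cdKernel c n (cis x) (cis θ) := fun x => by
    simp only [← cdPoly_eval]
    exact (cdPoly c n (cis x)).continuous.comp h1
  simp only [← cdKernel_conj c n (cis ψ)]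
  exact ((h1.comp (by fun_prop)).mul (h2 φ)).mul (Complex.continuous_conj.comp (h2 ψ))

theorem intervalIntegrable_conjIntegrand {c : ℤ → ℂ}
    (hh : ∀ j, c (-j) = (starRingEnd ℂ) (c j))
    (hc : ∀ N, (toeplitz c N).PosDef) {n : ℕ} {b : ℂ} (k : ℤ) {φ : ℝ}
    (h₁ : (popuc c n b).eval (cis φ) = 0) (h₂ : (popuc c n b).eval (cis (-φ)) = 0) :
    IntervalIntegrable (conjIntegrand c n k φ) MeasureTheory.volume 0 (2 * Real.pi) :=
  ((continuous_const.mul (continuous_kernel_product c n k φ (-φ))).intervalIntegrable _ _).congr_ae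
    (MeasureTheory.ae_restrict_of_ae (conjIntegrand_ae_eq hh hc k h₁ h₂).symm)

theorem bConj_eq {c : ℤ → ℂ} (hh : ∀ j, c (-j) = (starRingEnd ℂ) (c j))
    (hc : ∀ N, (toeplitz c N).PosDef) {n : ℕ} {b : ℂ} (k : ℤ) {φ : ℝ}
    (h₁ : (popuc c n b).eval (cis φ) = 0) (h₂ : (popuc c n b).eval (cis (-φ)) = 0) :
    bConj c n k φ = -(cis φ * ((‖(opuc c n).eval (cis φ)‖ ^ 2 : ℝ) : ℂ) /
        ((opuc c n).eval (cis (-φ)) * (starRingEnd ℂ) ((opuc c n).eval (cis φ)))) *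
      kernelMean c n k φ (-φ) := by
  rw [bConj, kernelMean, intervalIntegral.integral_congr_ae
    ((conjIntegrand_ae_eq hh hc k h₁ h₂).mono fun θ hθ _ => hθ),
    intervalIntegral.integral_const_mul]
  ring

/-! ### Differentiation in the parameter and the variation identity -/

theorem hasDerivAt_eval {p : ℝ → ℂ[X]} {d : ℂ[X]} {N : ℕ} {t : ℝ} {z : ℝ → ℂ} {z' : ℂ}
    (hp : ∀ s, (p s).natDegree < N) (hd : d.natDegree < N)
    (h : ∀ j, HasDerivAt (fun s => (p s).coeff j) (d.coeff j) t) (hz : HasDerivAt z z' t) :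
    HasDerivAt (fun s => (p s).eval (z s))
      (d.eval (z t) + (derivative (p t)).eval (z t) * z') t := by
  have h1 : HasDerivAt (fun s => ∑ j ∈ Finset.range N, (p s).coeff j * z s ^ j)
      (∑ j ∈ Finset.range N, (d.coeff j * z t ^ j + (p t).coeff j * (j * z t ^ (j - 1) * z'))) t :=
    HasDerivAt.fun_sum fun j _ => (h j).mul (hz.pow j)
  simp only [eval_eq_sum_range' (hp _)]
  convert h1 using 1
  rw [Finset.sum_add_distrib, ← eval_eq_sum_range' hd, derivative_eval,
    sum_over_range' _ (fun _ => by simp) N (hp t), Finset.sum_mul]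
  congr 1
  exact Finset.sum_congr rfl fun _ _ => by ring

theorem hasDerivAt_momentForm {c : ℝ → ℤ → ℂ} {c' : ℤ → ℂ} {p : ℝ → ℂ[X]} {d : ℂ[X]} {N : ℕ}
    {t : ℝ} (hp : ∀ s, (p s).natDegree < N) (hd : d.natDegree < N)
    (h : ∀ j, HasDerivAt (fun s => (p s).coeff j) (d.coeff j) t)
    (hc : ∀ j, HasDerivAt (fun s => c s j) (c' j) t) (q : ℂ[X]) :
    HasDerivAt (fun s => momentForm (c s) (p s) q)
      (momentForm (c t) d q + momentForm c' (p t) q) t := by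
  have h1 : HasDerivAt (fun s => ∑ j ∈ Finset.range N, ∑ l ∈ Finset.range (q.natDegree + 1),
      (p s).coeff j * (starRingEnd ℂ) (q.coeff l) * c s ((l : ℤ) - (j : ℤ)))
      (∑ j ∈ Finset.range N, ∑ l ∈ Finset.range (q.natDegree + 1),
        (d.coeff j * (starRingEnd ℂ) (q.coeff l) * c t ((l : ℤ) - (j : ℤ)) +
        (p t).coeff j * (starRingEnd ℂ) (q.coeff l) * c' ((l : ℤ) - (j : ℤ)))) t :=
    HasDerivAt.fun_sum fun j _ => HasDerivAt.fun_sum fun l _ => ((h j).mul_const _).mul (hc _)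
  simp only [momentForm_eq_sum _ (hp _) (Nat.lt_succ_self q.natDegree),
    momentForm_eq_sum _ hd (Nat.lt_succ_self q.natDegree), ← Finset.sum_add_distrib]
  exact h1

/-- `D` is the t-derivative of P, and `hDζ`, `hDω` say that ζ and ω move with angular velocities x
and y. These values fix `D` modulo (X - ζ)(X - ω), and the multiples of that product of degree at
most n are orthogonal to `X * S`. So ⟨D, XS⟩ is computable from x and y, and `hDS` equates it with
the variation of the moments. -/
theorem variation_identity {c : ℤ → ℂ} (hh : ∀ j, c (-j) = (starRingEnd ℂ) (c j))
    (hc : ∀ N, (toeplitz c N).PosDef) {n : ℕ} {b ζ ω : ℂ} (hζ : ζ * (starRingEnd ℂ) ζ = 1)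
    (hω : ω * (starRingEnd ℂ) ω = 1) (hne : ζ ≠ ω) {S D : ℂ[X]} (c' : ℤ → ℂ) {x y : ℂ}
    (hS : popuc c n b = (X - C ζ) * ((X - C ω) * S)) (hD : D.natDegree < n + 1)
    (hDζ : D.eval ζ + (derivative (popuc c n b)).eval ζ * (Complex.I * x * ζ) = 0)
    (hDω : D.eval ω + (derivative (popuc c n b)).eval ω * (Complex.I * y * ω) = 0)
    (hDS : momentForm c D (X * S) + momentForm c' (popuc c n b) (X * S) = 0) :
    x * momentForm c ((X - C ω) * S) ((X - C ω) * S) -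
        y * momentForm c ((X - C ζ) * S) ((X - C ζ) * S) =
      Complex.I * (1 - ζ * (starRingEnd ℂ) ω) *
        momentForm c' ((X - C ω) * S) ((X - C ζ) * S) := by
  have hS' : popuc c n b = (X - C ω) * ((X - C ζ) * S) := by rw [hS]; ring
  have hS0 : S ≠ 0 := by
    rintro rfl
    exact (popuc_monic hc n b).ne_zero (by rw [hS, mul_zero, mul_zero])
  have hSn : S.natDegree + 1 = n := by
    have := popuc_natDegree hc n b
    rw [hS, Monic.natDegree_mul' (monic_X_sub_C _) (mul_ne_zero (X_sub_C_ne_zero _) hS0),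
      Monic.natDegree_mul' (monic_X_sub_C _) hS0, natDegree_X_sub_C, natDegree_X_sub_C] at this
    omega
  have hSdeg : S.degree < n := by rw [← natDegree_lt_iff_degree_lt hS0]; omega
  set R₁ := (X - C ω) * S with hR₁
  set R₂ := (X - C ζ) * S with hR₂
  have hd : ∀ u : ℂ, ((X - C u) * S).natDegree ≤ n := fun u => by
    rw [Monic.natDegree_mul' (monic_X_sub_C _) hS0, natDegree_X_sub_C]; omega
  -- P'(ζ) = R₁(ζ) and P'(ω) = R₂(ω), so this correction of `D` vanishes at both zeros.
  set E := D + C (Complex.I * x * ζ) * R₁ + C (Complex.I * y * ω) * R₂ with hE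
  have hEd : E.natDegree ≤ n := by
    refine natDegree_add_le_of_degree_le (natDegree_add_le_of_degree_le (by omega) ?_) ?_
    · exact (natDegree_C_mul_le _ _).trans (hd ω)
    · exact (natDegree_C_mul_le _ _).trans (hd ζ)
  have hEζ : E.IsRoot ζ := by
    rw [hS] at hDζ
    simp only [derivative_mul, derivative_sub, derivative_X, derivative_C, eval_add, eval_mul,
      eval_sub, eval_X, eval_C, sub_self, zero_mul, add_zero, sub_zero, one_mul]
      at hDζ
    simp only [IsRoot, hE, hR₂, eval_add, eval_mul, eval_sub, eval_X, eval_C, sub_self, zero_mul,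
      mul_zero, add_zero]
    linear_combination hDζ
  have hEω : E.IsRoot ω := by
    rw [hS'] at hDω
    simp only [derivative_mul, derivative_sub, derivative_X, derivative_C, eval_add, eval_mul,
      eval_sub, eval_X, eval_C, sub_self, zero_mul, add_zero, sub_zero, one_mul]
      at hDω
    simp only [IsRoot, hE, hR₁, eval_add, eval_mul, eval_sub, eval_X, eval_C, sub_self, zero_mul,
      mul_zero, add_zero]
    linear_combination hDω
  obtain ⟨g, hg⟩ := IsCoprime.mul_dvd
    (isCoprime_X_sub_C_of_isUnit_sub (sub_ne_zero.2 hne).isUnit)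
    (dvd_iff_isRoot.2 hEζ) (dvd_iff_isRoot.2 hEω)
  have hgdeg : g.degree < n := by
    rcases eq_or_ne g 0 with rfl | hg0
    · rw [degree_zero]; exact WithBot.bot_lt_coe _
    · rw [← natDegree_lt_iff_degree_lt hg0]
      rw [hg, Monic.natDegree_mul' ((monic_X_sub_C _).mul (monic_X_sub_C _)) hg0,
        Monic.natDegree_mul (monic_X_sub_C _) (monic_X_sub_C _), natDegree_X_sub_C,
        natDegree_X_sub_C] at hEd
      omega
  -- The factor X - ζ moves across to form R₂, the cofactor of ω, which is orthogonal to (X - ω)g.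
  have hES : momentForm c E (X * S) = 0 := by
    rw [hg, mul_assoc, momentForm_circle c hζ, ← momentForm_symm hh,
      momentForm_cofactor hh hω hS' hgdeg, map_zero, mul_zero]
  have h12 : momentForm c R₁ R₂ = 0 := momentForm_cofactor hh hζ hS hSdeg
  have h21 : momentForm c R₂ R₁ = 0 := momentForm_cofactor hh hω hS' hSdeg
  have hdiff : C (ζ - ω) * S = R₁ - R₂ := by rw [hR₁, hR₂, C_sub]; ring
  have h1S : (starRingEnd ℂ) (ζ - ω) * momentForm c R₁ S = momentForm c R₁ R₁ := by
    rw [← momentForm_C_mul_right, hdiff, map_sub, h12, sub_zero]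
  have h2S : (starRingEnd ℂ) (ζ - ω) * momentForm c R₂ S = -momentForm c R₂ R₂ := by
    rw [← momentForm_C_mul_right, hdiff, map_sub, h21, zero_sub]
  have h1X : momentForm c R₁ (X * S) = (starRingEnd ℂ) ζ * momentForm c R₁ S := by
    rw [show X * S = R₂ + C ζ * S by rw [hR₂]; ring, map_add, h12, momentForm_C_mul_right, zero_add]
  have h2X : momentForm c R₂ (X * S) = (starRingEnd ℂ) ω * momentForm c R₂ S := by
    rw [show X * S = R₁ + C ω * S by rw [hR₁]; ring, map_add, h21, momentForm_C_mul_right, zero_add]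
  rw [hS, momentForm_circle c' hζ, ← hR₂] at hDS
  rw [hE, map_add, map_add, LinearMap.add_apply, LinearMap.add_apply, momentForm_C_mul_left,
    momentForm_C_mul_left, h1X, h2X] at hES
  rw [map_sub] at h1S h2S
  have hI := Complex.I_sq
  have k1 : (starRingEnd ℂ ζ - starRingEnd ℂ ω) * momentForm c D (X * S) +
      Complex.I * x * momentForm c R₁ R₁ - Complex.I * y * momentForm c R₂ R₂ = 0 := by
    linear_combination (starRingEnd ℂ ζ - starRingEnd ℂ ω) * hES
      - Complex.I * x * (starRingEnd ℂ ζ - starRingEnd ℂ ω) * momentForm c R₁ S * hζ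
      - Complex.I * y * (starRingEnd ℂ ζ - starRingEnd ℂ ω) * momentForm c R₂ S * hω
      - Complex.I * x * h1S - Complex.I * y * h2S
  linear_combination (-Complex.I) * k1
    + Complex.I * (starRingEnd ℂ ζ - starRingEnd ℂ ω) * hDS
    + (x * momentForm c R₁ R₁ - y * momentForm c R₂ R₂) * hI
    + Complex.I * momentForm c' R₁ R₂ * hζ

/-- The weight i(1 - ζω̄)(z - ω)·conj(z - ζ)·|S|² is real on the unit circle, so conjugation affects
only the moment sequence. -/
theorem momentForm_phase_conj (e : ℤ → ℂ) {ζ ω : ℂ} (hζ : ζ * (starRingEnd ℂ) ζ = 1)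
    (hω : ω * (starRingEnd ℂ) ω = 1) (S : ℂ[X]) :
    Complex.I * (1 - ζ * (starRingEnd ℂ) ω) * momentForm e ((X - C ω) * S) ((X - C ζ) * S) =
      (starRingEnd ℂ) (Complex.I * (1 - ζ * (starRingEnd ℂ) ω) *
        momentForm (fun j => (starRingEnd ℂ) (e (-j))) ((X - C ω) * S) ((X - C ζ) * S)) := by
  have h1 := momentForm_conj (fun j => (starRingEnd ℂ) (e (-j))) ((X - C ω) * S) ((X - C ζ) * S)
  simp only [neg_neg, Complex.conj_conj] at h1
  rw [map_mul (starRingEnd ℂ) (Complex.I * _), h1]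
  simp only [sub_mul X, map_sub, LinearMap.sub_apply,
    momentForm_X_mul_X_mul, momentForm_C_mul_left, momentForm_C_mul_right, map_mul, map_one,
    Complex.conj_I, Complex.conj_conj]
  linear_combination (-2 * Complex.I * momentForm e S S) *
      (ω * (starRingEnd ℂ) ω * hζ + hω)
    + Complex.I * momentForm e (X * S) S * ((starRingEnd ℂ) ω * hζ + (starRingEnd ℂ) ζ * hω)
    + Complex.I * momentForm e S (X * S) * (ω * hζ + ζ * hω)

/-- For a sequence supported at `k` and `-k`, the phase-normalized moment form is a positive
multiple of `Re (conj β * c' k)`, where `β` is its value for the unit sequence at `-k`. -/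
theorem momentForm_derivative_sequence {k : ℤ} {a : ℂ} {c' : ℤ → ℂ} (hk : c' k = a)
    (hk' : c' (-k) = (starRingEnd ℂ) a) (h0 : ∀ j, j ≠ k → j ≠ -k → c' j = 0) {ζ ω : ℂ}
    (hζ : ζ * (starRingEnd ℂ) ζ = 1) (hω : ω * (starRingEnd ℂ) ω = 1) (S : ℂ[X]) :
    ∃ r : ℝ, 0 < r ∧ Complex.I * (1 - ζ * (starRingEnd ℂ) ω) *
      momentForm c' ((X - C ω) * S) ((X - C ζ) * S) =
      ((r * ((starRingEnd ℂ) (Complex.I * (1 - ζ * (starRingEnd ℂ) ω) *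
        momentForm (Pi.single (-k) 1) ((X - C ω) * S) ((X - C ζ) * S)) * a).re : ℝ) : ℂ) := by
  -- For k = 0 the two unit sequences coincide and would count the real number a twice, hence r = 1
  -- there and r = 2 otherwise.
  obtain ⟨r, hr, hc'⟩ : ∃ r : ℝ, 0 < r ∧ c' = ((r / 2 : ℝ) : ℂ) • (a • Pi.single k (1 : ℂ) +
      (starRingEnd ℂ) a • Pi.single (-k) (1 : ℂ)) := by
    rcases eq_or_ne k 0 with rfl | hk0
    · refine ⟨1, one_pos, ?_⟩
      funext j
      rcases eq_or_ne j 0 with rfl | hj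
      · rw [neg_zero] at hk'
        simp [← hk', hk]
        ring
      · simp [hj, h0]
    · refine ⟨2, two_pos, ?_⟩
      have : k ≠ -k := by omega
      funext j
      rcases eq_or_ne j k with rfl | hj
      · simp [this, hk]
      · rcases eq_or_ne j (-k) with rfl | hj'
        · simp [hj, hk']
        · simp [hj, hj', h0]
  refine ⟨r, hr, ?_⟩
  set β := Complex.I * (1 - ζ * (starRingEnd ℂ) ω) *
        momentForm (Pi.single (-k) 1) ((X - C ω) * S) ((X - C ζ) * S) with hβ
  have hβ' : Complex.I * (1 - ζ * (starRingEnd ℂ) ω) *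
      momentForm (Pi.single k 1) ((X - C ω) * S) ((X - C ζ) * S) = (starRingEnd ℂ) β := by
    rw [momentForm_phase_conj _ hζ hω, hβ]
    suffices H : (fun j : ℤ => (starRingEnd ℂ) ((Pi.single k 1 : ℤ → ℂ) (-j))) =
        Pi.single (-k) 1 by rw [H]
    funext j
    by_cases hj : j = -k
    · subst hj; simp
    · have : -j ≠ k := by omega
      simp [hj, this]
  rw [hc', momentForm_smul, momentForm_add, momentForm_smul, momentForm_smul]
  have h2 : ((2 * ((starRingEnd ℂ) β * a).re : ℝ) : ℂ) =
      (starRingEnd ℂ) β * a + β * (starRingEnd ℂ) a := by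
    have := Complex.add_conj ((starRingEnd ℂ) β * a)
    rw [map_mul (starRingEnd ℂ) _ a, Complex.conj_conj] at this
    exact this.symm
  push_cast at h2 ⊢
  linear_combination (r / 2 * a : ℂ) * hβ' - (r / 2 : ℂ) * h2
    - (r / 2 * (starRingEnd ℂ) a) * hβ

/-! ### Families of moments and the velocities of zeros -/

/-- A family of positive definite moment sequences, in which only the moments of index `k` and `-k`
vary, together with a unimodular boundary parameter. -/
structure IsMomentPath (J : Set ℝ) (k : ℤ) (c : ℝ → ℤ → ℂ) (b : ℝ → ℂ) : Prop where
  isOpen : IsOpen J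
  herm : ∀ t ∈ J, ∀ j : ℤ, c t (-j) = (starRingEnd ℂ) (c t j)
  const : ∀ s ∈ J, ∀ t ∈ J, ∀ j : ℤ, j ≠ k → j ≠ -k → c s j = c t j
  contDiffOn : ContDiffOn ℝ 1 (fun t => c t k) J
  posDef : ∀ t ∈ J, ∀ N : ℕ, (toeplitz (c t) N).PosDef
  norm_eq_one : ∀ t ∈ J, ‖b t‖ = 1
  contDiffOn_param : ContDiffOn ℝ 1 b J

theorem contDiffOn_conj {J : Set ℝ} {f : ℝ → ℂ} (hf : ContDiffOn ℝ 1 f J) :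
    ContDiffOn ℝ 1 (fun t => (starRingEnd ℂ) (f t)) J :=
  Complex.conjCLE.contDiff.comp_contDiffOn hf

theorem contDiffOn_det {J : Set ℝ} {m : ℕ} {M : ℝ → Matrix (Fin m) (Fin m) ℂ}
    (hM : ∀ i j, ContDiffOn ℝ 1 (fun t => M t i j) J) :
    ContDiffOn ℝ 1 (fun t => (M t).det) J := by
  simp only [Matrix.det_apply']
  exact ContDiffOn.sum fun σ _ => contDiffOn_const.mul (contDiffOn_prod fun i _ => hM _ _)

namespace IsMomentPath

variable {J : Set ℝ} {k : ℤ} {c : ℝ → ℤ → ℂ} {b : ℝ → ℂ}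

theorem contDiffOn_moment (H : IsMomentPath J k c b) (j : ℤ) :
    ContDiffOn ℝ 1 (fun t => c t j) J := by
  rcases eq_or_ne j k with rfl | hj
  · exact H.contDiffOn
  rcases eq_or_ne j (-k) with rfl | hj'
  · exact (contDiffOn_conj H.contDiffOn).congr fun t ht => H.herm t ht k
  · rcases J.eq_empty_or_nonempty with rfl | ⟨s, hs⟩
    · exact contDiffOn_empty
    · exact (contDiffOn_const (c := c s j)).congr fun t ht => H.const t ht s hs j hj hj'

theorem contDiffOn_opuc_coeff (H : IsMomentPath J k c b) (n j : ℕ) :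
    ContDiffOn ℝ 1 (fun t => (opuc (c t) n).coeff j) J := by
  rcases lt_or_ge n j with hj | hj
  · simp only [coeff_eq_zero_of_natDegree_lt ((opuc_natDegree_le _ n).trans_lt hj)]
    exact contDiffOn_const
  · have h : ∀ t, (opuc (c t) n).coeff j = opucCoeff (c t) n ⟨j, Nat.lt_succ_of_le hj⟩ :=
      fun t => opuc_coeff (c t) n ⟨j, Nat.lt_succ_of_le hj⟩
    simp only [h, opucCoeff, div_eq_mul_inv]
    exact (contDiffOn_const.mul (contDiffOn_det fun _ _ => H.contDiffOn_moment _)).mul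
      ((contDiffOn_det fun _ _ => H.contDiffOn_moment _).inv
        fun t ht => (H.posDef t ht n).det_pos.ne')

theorem contDiffOn_popuc_coeff (H : IsMomentPath J k c b) (n j : ℕ) :
    ContDiffOn ℝ 1 (fun t => (popuc (c t) n (b t)).coeff j) J := by
  simp only [popuc, coeff_sub, coeff_C_mul]
  refine ContDiffOn.sub ?_ ((contDiffOn_conj H.contDiffOn_param).mul ?_)
  · cases j with
    | zero => simpa using contDiffOn_const
    | succ j => simpa only [coeff_X_mul] using H.contDiffOn_opuc_coeff n j
  · simp only [opucStar, coeff_reflect, coeff_map]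
    exact contDiffOn_conj (H.contDiffOn_opuc_coeff n _)

theorem mem_nhds (H : IsMomentPath J k c b) {t : ℝ} (ht : t ∈ J) : J ∈ 𝓝 t := H.isOpen.mem_nhds ht

/-- The derivative of the paraorthogonal polynomial, as a polynomial. -/
theorem exists_derivative_popuc (H : IsMomentPath J k c b) (n : ℕ) {t : ℝ} (ht : t ∈ J) :
    ∃ D : ℂ[X], D.natDegree < n + 1 ∧
      ∀ j, HasDerivAt (fun s => (popuc (c s) n (b s)).coeff j) (D.coeff j) t := by
  have hd : ∀ j, HasDerivAt (fun s => (popuc (c s) n (b s)).coeff j)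
      (deriv (fun s => (popuc (c s) n (b s)).coeff j) t) t := fun j =>
    (((H.contDiffOn_popuc_coeff n j).contDiffAt (H.mem_nhds ht)).differentiableAt
      one_ne_zero).hasDerivAt
  refine ⟨∑ j ∈ Finset.range (n + 1),
    C (deriv (fun s => (popuc (c s) n (b s)).coeff j) t) * X ^ j, ?_, fun j => ?_⟩
  · rw [Nat.lt_succ_iff]
    exact natDegree_sum_le_of_forall_le _ _ fun j hj =>
      (natDegree_C_mul_X_pow_le _ _).trans (Nat.lt_succ_iff.1 (Finset.mem_range.1 hj))
  · have hcoeff : (∑ i ∈ Finset.range (n + 1),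
        C (deriv (fun s => (popuc (c s) n (b s)).coeff i) t) * X ^ i).coeff j =
        if j < n + 1 then deriv (fun s => (popuc (c s) n (b s)).coeff j) t else 0 := by
      simp [finsetSum_coeff]
    rw [hcoeff]
    split_ifs with hj
    · exact hd j
    -- P stays monic of degree n + 1, so its higher coefficients are locally constant and the
    -- derivative has degree at most n.
    · have hev : (fun s => (popuc (c s) n (b s)).coeff j) =ᶠ[𝓝 t]
          fun _ => if j = n + 1 then 1 else 0 := by
        filter_upwards [H.mem_nhds ht] with s hs
        split_ifs with hj'
        · rw [hj', popuc_coeff_succ_self (H.posDef s hs)]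
        · exact coeff_eq_zero_of_natDegree_lt
            ((popuc_natDegree_le _ n _).trans_lt (by omega))
      exact (hasDerivAt_const t _).congr_of_eventuallyEq hev

theorem hasDerivAt_moment (H : IsMomentPath J k c b) {t : ℝ} (ht : t ∈ J) (j : ℤ) :
    HasDerivAt (fun s => c s j) (deriv (fun s => c s j) t) t :=
  (((H.contDiffOn_moment j).contDiffAt (H.mem_nhds ht)).differentiableAt one_ne_zero).hasDerivAt

theorem deriv_moment_neg (H : IsMomentPath J k c b) {t : ℝ} (ht : t ∈ J) :
    deriv (fun s => c s (-k)) t = (starRingEnd ℂ) (deriv (fun s => c s k) t) := by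
  refine HasDerivAt.deriv ?_
  have h := Complex.conjCLE.hasFDerivAt.comp_hasDerivAt t (H.hasDerivAt_moment ht k)
  refine h.congr_of_eventuallyEq ?_
  filter_upwards [H.mem_nhds ht] with s hs
  exact H.herm s hs k

theorem deriv_moment_eq_zero (H : IsMomentPath J k c b) {t : ℝ} (ht : t ∈ J) {j : ℤ} (hj : j ≠ k)
    (hj' : j ≠ -k) : deriv (fun s => c s j) t = 0 := by
  refine HasDerivAt.deriv ((hasDerivAt_const t (c t j)).congr_of_eventuallyEq ?_)
  filter_upwards [H.mem_nhds ht] with s hs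
  exact H.const s hs t ht j hj hj'

theorem root_velocity {n : ℕ} {t : ℝ} {D : ℂ[X]} (hD : D.natDegree < n + 1)
    (hd : ∀ j, HasDerivAt (fun s => (popuc (c s) n (b s)).coeff j) (D.coeff j) t)
    {φ : ℝ → ℝ} {x : ℝ} (hφ : HasDerivAt φ x t)
    (h0 : ∀ᶠ s in 𝓝 t, (popuc (c s) n (b s)).eval (cis (φ s)) = 0) :
    D.eval (cis (φ t)) + (derivative (popuc (c t) n (b t))).eval (cis (φ t)) *
      (Complex.I * x * cis (φ t)) = 0 := by
  have h := hasDerivAt_eval (N := n + 2)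
    (fun s => Nat.lt_succ_of_le (popuc_natDegree_le (c s) n (b s))) (by omega) hd
    (hasDerivAt_cis hφ)
  exact h.unique ((hasDerivAt_const t (0 : ℂ)).congr_of_eventuallyEq h0)

/-- Zero curves which meet have the same angular velocity there. -/
theorem velocity_eq_of_meet (H : IsMomentPath J k c b) {n : ℕ} {t : ℝ} (ht : t ∈ J)
    {φ ψ : ℝ → ℝ} {x y : ℝ} (hφ : HasDerivAt φ x t) (hψ : HasDerivAt ψ y t)
    (hφ0 : ∀ᶠ s in 𝓝 t, (popuc (c s) n (b s)).eval (cis (φ s)) = 0)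
    (hψ0 : ∀ᶠ s in 𝓝 t, (popuc (c s) n (b s)).eval (cis (ψ s)) = 0)
    (h : cis (φ t) = cis (ψ t)) : x = y := by
  obtain ⟨D, hD, hd⟩ := H.exists_derivative_popuc n ht
  have h1 := root_velocity hD hd hφ hφ0
  have h2 := root_velocity hD hd hψ hψ0
  rw [← h] at h2
  have h3 := popuc_derivative_ne_zero (H.herm t ht) (H.posDef t ht) (H.norm_eq_one t ht)
    hφ0.self_of_nhds
  have h4 := mul_left_cancel₀ h3 (add_left_cancel (h1.trans h2.symm))
  exact_mod_cast mul_left_cancel₀ Complex.I_ne_zero (mul_right_cancel₀ (cis_ne_zero _) h4)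

/-- The values of Q_n in the denominator cancel those produced by `kernelMean_eq`; only the positive
factor ‖Q_n‖⁻⁴ remains. -/
theorem bFixed_eq {c : ℤ → ℂ} (hh : ∀ j, c (-j) = (starRingEnd ℂ) (c j))
    (hc : ∀ N, (toeplitz c N).PosDef) {n : ℕ} {b : ℂ} (k : ℤ) {φ ψ : ℝ} {R₁ R₂ : ℂ[X]}
    (h₁ : popuc c n b = (X - C (cis φ)) * R₁) (h₂ : popuc c n b = (X - C (cis ψ)) * R₂) :
    bFixed c n k ψ φ = ((sqNorm c (opuc c n) ^ 2)⁻¹ : ℝ) *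
      (Complex.I * (1 - cis φ * (starRingEnd ℂ) (cis ψ)) *
        momentForm (Pi.single (-k) 1) R₁ R₂) := by
  have hQ₁ : (starRingEnd ℂ) ((opuc c n).eval (cis φ)) ≠ 0 := by
    simpa using opuc_eval_ne_zero hh hc n (cis_mul_conj φ)
  have hQ₂ := opuc_eval_ne_zero hh hc n (cis_mul_conj ψ)
  have hN : (sqNorm c (opuc c n) : ℂ) ≠ 0 := by
    exact_mod_cast (sqNorm_pos hc (opuc_ne_zero hc n)).ne'
  have hψ := cis_mul_neg ψ
  rw [bFixed, kernelMean_eq hh hc k h₁ h₂, cis_conj ψ]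
  push_cast
  field_simp
  linear_combination (momentForm (Pi.single (-k) 1) R₁ R₂) * hψ

/-- The variational identity for two distinct zero curves. -/
theorem velocity_identity (H : IsMomentPath J k c b) {n : ℕ} {t : ℝ} (ht : t ∈ J)
    {φ ψ : ℝ → ℝ} {x y : ℝ} (hφ : HasDerivAt φ x t) (hψ : HasDerivAt ψ y t)
    (hφ0 : ∀ᶠ s in 𝓝 t, (popuc (c s) n (b s)).eval (cis (φ s)) = 0)
    (hψ0 : ∀ᶠ s in 𝓝 t, (popuc (c s) n (b s)).eval (cis (ψ s)) = 0)
    (hne : cis (φ t) ≠ cis (ψ t)) :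
    ∃ A > 0, ∃ B > 0, ∃ r > 0, x * A - y * B =
      r * ((starRingEnd ℂ) (bFixed (c t) n k (ψ t) (φ t)) * deriv (fun s => c s k) t).re := by
  have hh := H.herm t ht
  have hc := H.posDef t ht
  obtain ⟨D, hD, hd⟩ := H.exists_derivative_popuc n ht
  obtain ⟨S, hS⟩ := IsCoprime.mul_dvd
    (isCoprime_X_sub_C_of_isUnit_sub (sub_ne_zero.2 hne).isUnit)
    (dvd_iff_isRoot.2 hφ0.self_of_nhds) (dvd_iff_isRoot.2 hψ0.self_of_nhds)
  have hS1 : popuc (c t) n (b t) = (X - C (cis (φ t))) * ((X - C (cis (ψ t))) * S) := by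
    rw [hS]; ring
  have hS2 : popuc (c t) n (b t) = (X - C (cis (ψ t))) * ((X - C (cis (φ t))) * S) := by
    rw [hS]; ring
  have hS0 : S ≠ 0 := by
    rintro rfl
    exact (popuc_monic hc n (b t)).ne_zero (by rw [hS, mul_zero])
  -- S is frozen at time t; orthogonality to `X * S` uses only its degree, so it persists for all s
  -- and can be differentiated.
  have hSdeg : ∀ s ∈ J, momentForm (c s) (popuc (c s) n (b s)) (X * S) = 0 := by
    intro s hs
    refine momentForm_popuc_X_mul (H.herm s hs) (b s) ?_
    rw [← natDegree_lt_iff_degree_lt hS0]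
    have := popuc_natDegree hc n (b t)
    rw [hS, Monic.natDegree_mul' ((monic_X_sub_C _).mul (monic_X_sub_C _)) hS0,
      Monic.natDegree_mul (monic_X_sub_C _) (monic_X_sub_C _), natDegree_X_sub_C,
      natDegree_X_sub_C] at this
    omega
  have hder := hasDerivAt_momentForm (N := n + 2)
    (fun s => Nat.lt_succ_of_le (popuc_natDegree_le (c s) n (b s))) (by omega) hd
    (H.hasDerivAt_moment ht) (X * S)
  have hzero := hder.unique ((hasDerivAt_const t (0 : ℂ)).congr_of_eventuallyEq
    (Filter.mem_of_superset (H.mem_nhds ht) hSdeg))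
  have key := variation_identity hh hc (cis_mul_conj (φ t)) (cis_mul_conj (ψ t)) hne
    (fun j => deriv (fun s => c s j) t) hS1 hD (root_velocity hD hd hφ hφ0)
    (root_velocity hD hd hψ hψ0) hzero
  obtain ⟨r, hr, hr'⟩ := momentForm_derivative_sequence (k := k)
    (c' := fun j => deriv (fun s => c s j) t) rfl (H.deriv_moment_neg ht)
    (fun j hj hj' => H.deriv_moment_eq_zero ht hj hj') (cis_mul_conj (φ t)) (cis_mul_conj (ψ t)) S
  have hN := sqNorm_pos hc (opuc_ne_zero hc n)
  refine ⟨_, sqNorm_pos hc (mul_ne_zero (X_sub_C_ne_zero (cis (ψ t))) hS0), _,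
    sqNorm_pos hc (mul_ne_zero (X_sub_C_ne_zero (cis (φ t))) hS0),
    r * sqNorm (c t) (opuc (c t) n) ^ 2, by positivity, ?_⟩
  rw [bFixed_eq hh hc k hS1 hS2, map_mul (starRingEnd ℂ) (Complex.ofReal _), Complex.conj_ofReal,
    mul_assoc (Complex.ofReal _), Complex.re_ofReal_mul, mul_assoc r, mul_inv_cancel_left₀ (by positivity)]
  rw [hr', momentForm_self hc, momentForm_self hc] at key
  exact_mod_cast key

theorem sign_deriv_fixed (H : IsMomentPath J k c b) {n : ℕ} {t : ℝ} (ht : t ∈ J)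
    {φ : ℝ → ℝ} {x : ℝ} (hφ : HasDerivAt φ x t)
    (hφ0 : ∀ᶠ s in 𝓝 t, (popuc (c s) n (b s)).eval (cis (φ s)) = 0) {θ₀ : ℝ}
    (h0 : ∀ᶠ s in 𝓝 t, (popuc (c s) n (b s)).eval (cis θ₀) = 0) :
    SignType.sign x = SignType.sign ((starRingEnd ℂ) (bFixed (c t) n k θ₀ (φ t)) *
      deriv (fun s => c s k) t).re := by
  by_cases hne : cis (φ t) = cis θ₀
  -- At a meeting point the velocity is that of the constant curve, and b_k vanishes through its
  -- factor e^{iφ} - e^{iθ₀}.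
  · rw [H.velocity_eq_of_meet ht hφ (hasDerivAt_const t θ₀) hφ0 h0 hne]
    simp [bFixed, hne]
  · obtain ⟨A, hA, B, -, r, hr, h⟩ :=
      H.velocity_identity ht hφ (hasDerivAt_const t θ₀) hφ0 h0 hne
    have := congrArg SignType.sign h
    rwa [zero_mul, sub_zero, sign_mul, sign_mul, sign_pos hA, sign_pos hr, mul_one, one_mul] at this

/-- The difference e^{iφ} - e^{-iφ} = 2i Im e^{iφ} is the source of both the minus sign and sgn Im
e^{iφ} in the conjugate case. -/
theorem bFixed_neg_eq {c : ℤ → ℂ} (hh : ∀ j, c (-j) = (starRingEnd ℂ) (c j))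
    (hc : ∀ N, (toeplitz c N).PosDef) {n : ℕ} {b : ℂ} (k : ℤ) {φ : ℝ}
    (h₁ : (popuc c n b).eval (cis φ) = 0) (h₂ : (popuc c n b).eval (cis (-φ)) = 0) :
    bFixed c n k (-φ) φ =
      ((-(2 / ‖(opuc c n).eval (cis φ)‖ ^ 2) * (cis φ).im : ℝ) : ℂ) * bConj c n k φ := by
  have hQ := opuc_eval_ne_zero hh hc n (cis_mul_conj φ)
  have hQ' : (‖(opuc c n).eval (cis φ)‖ : ℂ) ≠ 0 := by exact_mod_cast norm_ne_zero_iff.2 hQ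
  have h : cis φ - cis (-φ) = 2 * (cis φ).im * Complex.I := by
    rw [← cis_conj, Complex.sub_conj]; push_cast; ring
  have hI := Complex.I_sq
  rw [bConj_eq hh hc k h₁ h₂, bFixed, neg_neg, h]
  push_cast
  field_simp
  linear_combination (-(cis φ * (cis φ).im * kernelMean c n k φ (-φ) *
    ((opuc c n).eval (cis (-φ)))⁻¹ * ((starRingEnd ℂ) ((opuc c n).eval (cis φ)))⁻¹)) * hI

theorem sign_deriv_conj (H : IsMomentPath J k c b) {n : ℕ} {t : ℝ} (ht : t ∈ J)
    {φ : ℝ → ℝ} {x : ℝ} (hφ : HasDerivAt φ x t)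
    (hφ0 : ∀ᶠ s in 𝓝 t, (popuc (c s) n (b s)).eval (cis (φ s)) = 0)
    (h0 : ∀ᶠ s in 𝓝 t, (popuc (c s) n (b s)).eval (cis (-φ s)) = 0) :
    SignType.sign x = -(SignType.sign (cis (φ t)).im *
      SignType.sign ((starRingEnd ℂ) (bConj (c t) n k (φ t)) * deriv (fun s => c s k) t).re) := by
  by_cases hne : cis (φ t) = cis (-φ t)
  -- The curves meet only at ±1, where Im e^{iφ} = 0, and equal velocities x and -x must be 0.
  · have hx : x = -x := H.velocity_eq_of_meet ht hφ hφ.neg hφ0 h0 hne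
    have him : (cis (φ t)).im = 0 := by
      rw [← cis_conj] at hne
      exact Complex.conj_eq_iff_im.1 hne.symm
    have hx0 : x = 0 := by linarith
    simp [him, hx0]
  · obtain ⟨A, hA, B, hB, r, hr, h⟩ := H.velocity_identity ht hφ hφ.neg hφ0 h0 hne
    have hQ := opuc_eval_ne_zero (H.herm t ht) (H.posDef t ht) n (cis_mul_conj (φ t))
    have hQ' : 0 < 2 / ‖(opuc (c t) n).eval (cis (φ t))‖ ^ 2 := by
      have := norm_pos_iff.2 hQ
      positivity
    have e := bFixed_neg_eq (H.herm t ht) (H.posDef t ht) k hφ0.self_of_nhds h0.self_of_nhds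
    have h' : x * (A + B) = r * (-(2 / ‖(opuc (c t) n).eval (cis (φ t))‖ ^ 2 *
        ((cis (φ t)).im * ((starRingEnd ℂ) (bConj (c t) n k (φ t)) *
          deriv (fun s => c s k) t).re))) := by
      have h'' : x * (A + B) = x * A - -x * B := by ring
      rw [h'']
      refine h.trans ?_
      simp only [Pi.neg_apply]
      rw [e, map_mul, Complex.conj_ofReal, mul_assoc, Complex.re_ofReal_mul]
      ring
    have := congrArg SignType.sign h'
    rwa [sign_mul, sign_pos (add_pos hA hB), mul_one, sign_mul, sign_pos hr, one_mul,
      Left.sign_neg, sign_mul, sign_pos hQ', one_mul, sign_mul] at this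

end IsMomentPath

/-! ### Existence of the zero curve and of its angle -/

/-- Simple zeros of polynomials with continuously differentiable coefficients move along
continuously differentiable curves. -/
theorem exists_root_curve {p : ℝ → ℂ[X]} {N : ℕ} (hp : ∀ s, (p s).natDegree < N) {t₀ : ℝ} {z₀ : ℂ}
    (hd : ∀ j, ContDiffAt ℝ 1 (fun s => (p s).coeff j) t₀) (h0 : (p t₀).eval z₀ = 0)
    (h1 : (derivative (p t₀)).eval z₀ ≠ 0) :
    ∃ ψ : ℝ → ℂ, ContDiffAt ℝ 1 ψ t₀ ∧ ψ t₀ = z₀ ∧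
      ∀ᶠ v in 𝓝 (t₀, z₀), (p v.1).eval v.2 = 0 ↔ ψ v.1 = v.2 := by
  set F : ℝ × ℂ → ℂ := fun v => (p v.1).eval v.2 with hF
  have hcd : ContDiffAt ℝ 1 F (t₀, z₀) := by
    have : F = fun v => ∑ j ∈ Finset.range N, (p v.1).coeff j * v.2 ^ j :=
      funext fun v => eval_eq_sum_range' (hp _) _
    rw [this]
    refine ContDiffAt.sum fun j _ => ContDiffAt.mul ?_ (contDiffAt_snd.pow j)
    exact ContDiffAt.comp (t₀, z₀) (g := fun s => (p s).coeff j) (hd j) contDiffAt_fst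
  -- The partial derivative in z is multiplication by the nonzero derivative of the polynomial at
  -- z₀, viewed as a real-linear map.
  have hinv : (fderiv ℝ F (t₀, z₀) ∘L .inr ℝ ℝ ℂ).IsInvertible := by
    have e1 : HasFDerivAt (fun z => F (t₀, z)) (fderiv ℝ F (t₀, z₀) ∘L .inr ℝ ℝ ℂ) z₀ :=
      (hcd.differentiableAt one_ne_zero).hasFDerivAt.comp z₀ (hasFDerivAt_prodMk_right t₀ z₀)
    have e2 := ((p t₀).hasDerivAt z₀).hasFDerivAt.restrictScalars ℝ
    rw [e1.unique e2]
    refine ⟨(ContinuousLinearEquiv.unitsEquivAut ℂ (Units.mk0 _ h1)).restrictScalars ℝ, ?_⟩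
    ext; simp
  refine ⟨hcd.implicitFunction one_ne_zero hinv, hcd.contDiffAt_implicitFunction one_ne_zero hinv,
    hcd.implicitFunction_apply_self one_ne_zero hinv, ?_⟩
  have := hcd.eventually_apply_eq_iff_implicitFunction one_ne_zero hinv
  simpa [hF, h0] using this

theorem cis_arg {z : ℂ} (hz : ‖z‖ = 1) : cis z.arg = z := by
  have := Complex.norm_mul_exp_arg_mul_I z
  rwa [hz, Complex.ofReal_one, one_mul, mul_comm] at this

/-- Within distance 1 of ζ₀ the ratio ζ(t)/ζ₀ stays in the slit plane, so the principal logarithm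
yields a differentiable angle. -/
theorem exists_angle {ζ : ℝ → ℂ} {s : Set ℝ} {ζ₀ : ℂ} (h₀ : ‖ζ₀‖ = 1)
    (hζ : ∀ t ∈ s, ζ t ∈ arc ζ₀ 1) (hd : DifferentiableOn ℝ ζ s) :
    ∃ φ : ℝ → ℝ, DifferentiableOn ℝ φ s ∧ ∀ t ∈ s, ζ t = cis (φ t) := by
  have h₀' : ζ₀ ≠ 0 := fun h => by simp [h] at h₀
  refine ⟨fun t => ζ₀.arg + (Complex.log (ζ t / ζ₀)).im, fun t ht => ?_, fun t ht => ?_⟩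
  · have hslit : ζ t / ζ₀ ∈ Complex.slitPlane := by
      have := (hζ t ht).1
      rw [Metric.mem_ball, dist_eq_norm] at this
      have h2 : ζ t / ζ₀ = 1 + (ζ t - ζ₀) / ζ₀ := by field_simp; ring
      rw [h2]
      apply Complex.mem_slitPlane_of_norm_lt_one
      rwa [norm_div, h₀, div_one]
    have h3 : DifferentiableWithinAt ℝ (fun t => Complex.log (ζ t / ζ₀)) s t :=
      (((hd t ht).hasDerivWithinAt.div_const ζ₀).clog_real hslit).differentiableWithinAt
    exact (Complex.imCLM.differentiableAt.comp_differentiableWithinAt t h3).const_add _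
  · have h1 : ‖ζ t‖ = 1 := by simpa using (hζ t ht).2
    rw [cis_add, cis_arg h₀, Complex.log_im, cis_arg (by rw [norm_div, h1, h₀, div_one])]
    field_simp

theorem norm_eq_one_of_mul_conj {z : ℂ} (hz : z * (starRingEnd ℂ) z = 1) : ‖z‖ = 1 := by
  rw [Complex.mul_conj, Complex.normSq_eq_norm_sq] at hz
  have : ‖z‖ ^ 2 = 1 := by exact_mod_cast hz
  exact (pow_eq_one_iff_of_nonneg (norm_nonneg z) two_ne_zero).1 this

end

end Popuc

/-! ### The local zero curve and the sign rules -/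

theorem theorem3 (n : ℕ) (k : ℤ) (J : Set ℝ) (hJo : IsOpen J) (hJc : J.OrdConnected)
    (hJ0 : (0 : ℝ) ∈ J)
    -- `c t j` is the moment `c_j` at the parameter `t`; only `c_k` and `c_{-k}` depend on `t`
    (c : ℝ → ℤ → ℂ)
    (hherm : ∀ t ∈ J, ∀ j : ℤ, c t (-j) = (starRingEnd ℂ) (c t j))
    (hconst : ∀ s ∈ J, ∀ t ∈ J, ∀ j : ℤ, j ≠ k → j ≠ -k → c s j = c t j)
    (hck : ContDiffOn ℝ 1 (fun t => c t k) J)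
    (hpos : ∀ t ∈ J, ∀ N : ℕ, (Popuc.toeplitz (c t) N).PosDef)
    (b : ℝ → ℂ) (hb : ∀ t ∈ J, ‖b t‖ = 1) (hbd : ContDiffOn ℝ 1 b J)
    (ζ₀ : ℂ) (hζ₀ : (Popuc.popuc (c 0) n (b 0)).eval ζ₀ = 0) :
    ∃ ε > (0 : ℝ), ∃ δ > (0 : ℝ), Metric.ball (0 : ℝ) ε ⊆ J ∧ ∃ ζ : ℝ → ℂ,
      -- the differentiable zero curve
      (∀ t ∈ Metric.ball (0 : ℝ) ε, ζ t ∈ Popuc.arc ζ₀ δ) ∧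
      DifferentiableOn ℝ ζ (Metric.ball (0 : ℝ) ε) ∧
      ζ 0 = ζ₀ ∧
      (∀ t ∈ Metric.ball (0 : ℝ) ε, (Popuc.popuc (c t) n (b t)).eval (ζ t) = 0) ∧
      -- its uniqueness
      (∀ ξ : ℝ → ℂ, (∀ t ∈ Metric.ball (0 : ℝ) ε, ξ t ∈ Popuc.arc ζ₀ δ ∧
          (Popuc.popuc (c t) n (b t)).eval (ξ t) = 0) →
        Set.EqOn ξ ζ (Metric.ball (0 : ℝ) ε)) ∧
      -- its angle
      (∃ φ : ℝ → ℝ, DifferentiableOn ℝ φ (Metric.ball (0 : ℝ) ε) ∧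
        ∀ t ∈ Metric.ball (0 : ℝ) ε, ζ t = Popuc.cis (φ t)) ∧
      ∀ φ : ℝ → ℝ, DifferentiableOn ℝ φ (Metric.ball (0 : ℝ) ε) →
        (∀ t ∈ Metric.ball (0 : ℝ) ε, ζ t = Popuc.cis (φ t)) →
        -- conjugate zeros
        ((∀ t ∈ Metric.ball (0 : ℝ) ε,
            (Popuc.popuc (c t) n (b t)).eval (Popuc.cis (-φ t)) = 0) →
          ∀ t ∈ Metric.ball (0 : ℝ) ε,
            SignType.sign (deriv φ t) =
              -(SignType.sign (Popuc.cis (φ t)).im *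
                SignType.sign ((starRingEnd ℂ) (Popuc.bConj (c t) n k (φ t)) *
                  deriv (fun s => c s k) t).re) ∧
            IntervalIntegrable (Popuc.conjIntegrand (c t) n k (φ t)) MeasureTheory.volume
              0 (2 * Real.pi) ∧
            Popuc.bConj (c t) n k (φ t) =
              -(Popuc.cis (φ t) *
                  ((‖(Popuc.opuc (c t) n).eval (Popuc.cis (φ t))‖ ^ 2 : ℝ) : ℂ) /
                ((Popuc.opuc (c t) n).eval (Popuc.cis (-φ t)) *
                  (starRingEnd ℂ) ((Popuc.opuc (c t) n).eval (Popuc.cis (φ t))))) *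
              Popuc.kernelMean (c t) n k (φ t) (-φ t)) ∧
        -- a fixed second zero
        (∀ θ₀ : ℝ,
          (∀ t ∈ Metric.ball (0 : ℝ) ε,
            (Popuc.popuc (c t) n (b t)).eval (Popuc.cis θ₀) = 0) →
          ∀ t ∈ Metric.ball (0 : ℝ) ε,
            SignType.sign (deriv φ t) =
              SignType.sign ((starRingEnd ℂ) (Popuc.bFixed (c t) n k θ₀ (φ t)) *
                deriv (fun s => c s k) t).re) := by
  have H : Popuc.IsMomentPath J k c b := ⟨hJo, hherm, hconst, hck, hpos, hb, hbd⟩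
  have hnorm : ∀ t ∈ J, ∀ z, (Popuc.popuc (c t) n (b t)).eval z = 0 → ‖z‖ = 1 := fun t ht z hz =>
    Popuc.norm_eq_one_of_mul_conj
      (Popuc.popuc_root_mul_conj (hherm t ht) (hpos t ht) (hb t ht) hz)
  obtain ⟨ψ, hψd, hψ0, hψ⟩ := Popuc.exists_root_curve (p := fun t => Popuc.popuc (c t) n (b t))
    (N := n + 2) (fun s => Nat.lt_succ_of_le (Popuc.popuc_natDegree_le (c s) n (b s)))
    (fun j => (H.contDiffOn_popuc_coeff n j).contDiffAt (H.mem_nhds hJ0)) hζ₀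
    (Popuc.popuc_derivative_ne_zero (hherm 0 hJ0) (hpos 0 hJ0) (hb 0 hJ0) hζ₀)
  obtain ⟨r, hr, hψ⟩ := Metric.eventually_nhds_iff.1 hψ
  replace hψ : ∀ {t : ℝ} {z : ℂ}, dist t 0 < r → dist z ζ₀ < r →
      ((Popuc.popuc (c t) n (b t)).eval z = 0 ↔ ψ t = z) := fun {t z} ht hz =>
    hψ (y := (t, z)) (max_lt ht hz)
  -- Being C¹ at 0 spreads to nearby t. Radius r keeps the zero curve unique; radius 1 is what
  -- `exists_angle` needs.
  have hev : ∀ᶠ t in nhds (0 : ℝ), t ∈ J ∧ ContDiffAt ℝ 1 ψ t ∧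
      ψ t ∈ Metric.ball ζ₀ (min r 1) := by
    refine Filter.Eventually.and (H.mem_nhds hJ0)
      ((hψd.eventually (by simp)).and (hψd.continuousAt.eventually_mem ?_))
    rw [hψ0]
    exact Metric.ball_mem_nhds _ (lt_min hr one_pos)
  obtain ⟨ε, hε, hball⟩ := Metric.eventually_nhds_iff_ball.1 hev
  have hmem : ∀ t ∈ Metric.ball (0 : ℝ) (min r ε), dist t 0 < r ∧ t ∈ Metric.ball 0 ε :=
    fun t ht => ⟨(Metric.mem_ball.1 ht).trans_le (min_le_left _ _),
      Metric.ball_subset_ball (min_le_right _ _) ht⟩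
  have hJ : ∀ t ∈ Metric.ball (0 : ℝ) (min r ε), t ∈ J := fun t ht => (hball t (hmem t ht).2).1
  have hin : ∀ t ∈ Metric.ball (0 : ℝ) (min r ε), ψ t ∈ Metric.ball ζ₀ (min r 1) :=
    fun t ht => (hball t (hmem t ht).2).2.2
  have hroot : ∀ t ∈ Metric.ball (0 : ℝ) (min r ε),
      (Popuc.popuc (c t) n (b t)).eval (ψ t) = 0 := fun t ht =>
    (hψ (hmem t ht).1 ((Metric.mem_ball.1 (hin t ht)).trans_le (min_le_left _ _))).2 rfl
  have hdiff : DifferentiableOn ℝ ψ (Metric.ball (0 : ℝ) (min r ε)) := fun t ht =>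
    ((hball t (hmem t ht).2).2.1.differentiableAt one_ne_zero).differentiableWithinAt
  have harc : ∀ t ∈ Metric.ball (0 : ℝ) (min r ε), ψ t ∈ Popuc.arc ζ₀ (min r 1) := fun t ht =>
    ⟨hin t ht, by simpa using hnorm t (hJ t ht) _ (hroot t ht)⟩
  refine ⟨min r ε, lt_min hr hε, min r 1, lt_min hr one_pos, hJ, ψ, harc, hdiff, hψ0, hroot,
    ?_, ?_, ?_⟩
  · intro ξ hξ t ht
    exact ((hψ (hmem t ht).1 ((Metric.mem_ball.1 (hξ t ht).1.1).trans_le (min_le_left _ _))).1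
      (hξ t ht).2).symm
  · exact Popuc.exists_angle (hnorm 0 hJ0 ζ₀ hζ₀) (fun t ht =>
      ⟨Metric.ball_subset_ball (min_le_right _ _) (harc t ht).1, (harc t ht).2⟩) hdiff
  · intro φ hφd hφ
    have hnhds : ∀ t ∈ Metric.ball (0 : ℝ) (min r ε), Metric.ball (0 : ℝ) (min r ε) ∈ nhds t :=
      fun t ht => Metric.isOpen_ball.mem_nhds ht
    have hφroot : ∀ t ∈ Metric.ball (0 : ℝ) (min r ε),
        (Popuc.popuc (c t) n (b t)).eval (Popuc.cis (φ t)) = 0 := fun t ht => by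
      rw [← hφ t ht]; exact hroot t ht
    have hφ' : ∀ t ∈ Metric.ball (0 : ℝ) (min r ε), HasDerivAt φ (deriv φ t) t := fun t ht =>
      (hφd.differentiableAt (hnhds t ht)).hasDerivAt
    refine ⟨fun hconj t ht => ⟨?_, ?_, ?_⟩, fun θ₀ hfix t ht => ?_⟩
    · exact H.sign_deriv_conj (hJ t ht) (hφ' t ht)
        (Filter.mem_of_superset (hnhds t ht) hφroot) (Filter.mem_of_superset (hnhds t ht) hconj)
    · exact Popuc.intervalIntegrable_conjIntegrand (hherm t (hJ t ht)) (hpos t (hJ t ht)) k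
        (hφroot t ht) (hconj t ht)
    · exact Popuc.bConj_eq (hherm t (hJ t ht)) (hpos t (hJ t ht)) k (hφroot t ht) (hconj t ht)
    · exact H.sign_deriv_fixed (hJ t ht) (hφ' t ht)
        (Filter.mem_of_superset (hnhds t ht) hφroot) (Filter.mem_of_superset (hnhds t ht) hfix)
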